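/- Let $\ell\ge 1$ and let $(G,n)$ be one of $(O_{2\ell+1},2\ell+1)$ (type $B_\ell$), $(Sp_{2\ell},2\ell)$ (type $C_\ell$), $(O_{2\ell},2\ell)$ (type $D_\ell$). For $g\in GL_n(\mathbb C)$ put $(g^\tau)_{ij}=g_{n+1-j,\,n+1-i}$ and $$\theta_G(g)=S_G\,(g^\tau)^{-1}S_G^{-1},$$ where $S_G=\mathrm{diag}(1,-1,1,\dots)$ has alternating signs in types $B,C$, and in type $D$ is this matrix multiplied by $\mathrm{diag}(\mathrm{Id}_\ell,-\mathrm{Id}_\ell)$. The classical group is realized as $G=GL_n(\mathbb C)^{\theta_G}$. Let $H_n\subset GL_n(\mathbb C)$ be the diagonal torus, $N_n(H_n)$ its normalizer and $W_{GL_n}=N_n(H_n)/H_n$, with the induced action of $\theta_G$. Let $\mathfrak g=\{A\in\mathfrak{gl}_n(\mathbb C): A=-S_GA^\tau S_G^{-1}\}$, let $\mathfrak h\subset\mathfrak g$ be its subalgebra of diagonal matrices, let $\Phi_G\subset\mathfrak h^*$ be the set of roots of $\mathfrak g$ with respect to $\mathfrak h$, and let $\mathrm{Aut}(\Phi_G)$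 be the group of linear automorphisms of $\mathfrak h^*$ mapping $\Phi_G$ onto itself. Then $G$ has a maximal torus $T$ (maximal among all algebraic tori in $G$) with $T\subset H_n$. For every such $T$, let $H_G=C_G(T)$ be its centralizer in $G$. The group $H_G$ is a maximal commutative subgroup of $G$; in types $C$ and $D$ one has $H_G=T$, while in type $B$ one has $H_G=T\times\{\pm 1\}$. Moreover: 1. $H_n^{\theta_G}=H_G$. 2. $\bigl(N_n(H_n)\bigr)^{\theta_G}=N_G(H_G)$. 3. The inclusion $N_G(H_G)\subset N_n(H_n)$ induces an isomorphism $N_G(H_G)/H_G\cong (W_{GL_n})^{\theta_G}$. The conjugation action of $(W_{GL_n})^{\theta_G}$ on $\mathfrak h$ induces an injective homomorphism $(W_{GL_n})^{\theta_G}\to\mathrm{Aut}(\Phi_G)$, whose image consists of the automorphisms of $\Phi_G$ that preserve the lattice in $\mathfrak h^*$ spanned by the diagonal entries (the character lattice of $T$). Except in the types $D_1$ and $D_4$ this homomorphism is an isomorphism $$\bigl(W_{GL_n}\bigr)^{\theta_G}\;\cong\;\mathrm{Aut}(\Phi_G).$$ -/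

import Mathlib

open scoped MatrixGroups

namespace ClassicalTorus

/-! ### The general linear group and its diagonal torus -/

/-- The invertible diagonal matrix with prescribed diagonal entries, as a homomorphism. -/
noncomputable def diagHom (n : ℕ) : (Fin n → ℂˣ) →* GL (Fin n) ℂ where
  toFun d :=
    ⟨Matrix.diagonal fun i => (d i : ℂ), Matrix.diagonal fun i => ((d i)⁻¹ : ℂˣ),
      by simp [Matrix.diagonal_mul_diagonal], by simp [Matrix.diagonal_mul_diagonal]⟩
  map_one' := by ext i j; simp
  map_mul' a b := by
    apply Units.ext
    simp [Matrix.diagonal_mul_diagonal]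

/-- The group of invertible diagonal matrices. -/
noncomputable def diagTorus (n : ℕ) : Subgroup (GL (Fin n) ℂ) := (diagHom n).range

/-- Reflection in the opposite diagonal, `(A^τ)_{ij} = A_{n+1-j, n+1-i}` (with 1-based indices). -/
def antiTranspose {n : ℕ} (A : Matrix (Fin n) (Fin n) ℂ) : Matrix (Fin n) (Fin n) ℂ :=
  Matrix.of fun i j => A j.rev i.rev

theorem antiTranspose_one (n : ℕ) : antiTranspose (1 : Matrix (Fin n) (Fin n) ℂ) = 1 := by
  ext i j
  simp [antiTranspose, Matrix.one_apply, eq_comm]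

theorem antiTranspose_mul {n : ℕ} (A B : Matrix (Fin n) (Fin n) ℂ) :
    antiTranspose (A * B) = antiTranspose B * antiTranspose A := by
  ext i j
  simp only [antiTranspose, Matrix.of_apply, Matrix.mul_apply]
  rw [← Equiv.sum_comp Fin.revPerm]
  exact Finset.sum_congr rfl fun k _ => by simp [mul_comm]

/-- The involution `ι : g ↦ (g^τ)⁻¹` of the general linear group. -/
def iota (n : ℕ) : GL (Fin n) ℂ →* GL (Fin n) ℂ where
  toFun g :=
    ⟨antiTranspose ((g⁻¹ : GL (Fin n) ℂ) : Matrix (Fin n) (Fin n) ℂ),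
      antiTranspose (g : Matrix (Fin n) (Fin n) ℂ),
      by rw [← antiTranspose_mul, Units.mul_inv, antiTranspose_one],
      by rw [← antiTranspose_mul, Units.inv_mul, antiTranspose_one]⟩
  map_one' := by apply Units.ext; simp [antiTranspose_one]
  map_mul' a b := by
    apply Units.ext
    simp only [mul_inv_rev, Units.val_mul, antiTranspose_mul]

/-! ### The classical involutions -/

/-- The three series of classical groups `O_{2ℓ+1}` (type `B`), `Sp_{2ℓ}` (type `C`) and
`O_{2ℓ}` (type `D`). -/
inductive Series : Type
  | B : Series
  | C : Series
  | D : Series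

/-- The size of the matrices in the classical group of the given series and rank `ℓ`. -/
def size : Series → ℕ → ℕ
  | .B, l => 2 * l + 1
  | .C, l => 2 * l
  | .D, l => 2 * l

/-- The `i`-th diagonal entry (counted from `0`) of the diagonal sign matrix `S_G`:
alternating signs `1, -1, 1, …`, where in type `D` the signs of the second half are flipped. -/
def signEntry : Series → ℕ → ℕ → ℂˣ
  | .B, _, i => (-1) ^ i
  | .C, _, i => (-1) ^ i
  | .D, l, i => if i < l then (-1) ^ i else -(-1) ^ i

/-- The diagonal sign matrix `S_G`. -/
noncomputable def signMatrix (X : Series) (l : ℕ) : GL (Fin (size X l)) ℂ :=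
  diagHom _ fun i => signEntry X l i

/-- The involution `θ_G : g ↦ S_G (g^τ)⁻¹ S_G⁻¹`. -/
noncomputable def theta (X : Series) (l : ℕ) :
    GL (Fin (size X l)) ℂ →* GL (Fin (size X l)) ℂ :=
  (MulAut.conj (signMatrix X l)).toMonoidHom.comp (iota (size X l))

/-- The part of a subgroup that is fixed by `θ_G`. -/
noncomputable def fixedPart (X : Series) (l : ℕ) (K : Subgroup (GL (Fin (size X l)) ℂ)) :
    Subgroup (GL (Fin (size X l)) ℂ) :=
  K ⊓ (theta X l).eqLocus (MonoidHom.id _)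

/-- The classical group `G = GL^θ`. -/
noncomputable def classicalGroup (X : Series) (l : ℕ) : Subgroup (GL (Fin (size X l)) ℂ) :=
  fixedPart X l ⊤

/-! ### Tori, normalizers and quotients -/

/-- Algebraic tori in the general linear group: up to conjugation, the images of `(ℂˣ)^r` under
monomial homomorphisms into the diagonal matrices. -/
def IsTorus {n : ℕ} (T : Subgroup (GL (Fin n) ℂ)) : Prop :=
  ∃ (r : ℕ) (P : GL (Fin n) ℂ) (a : Fin n → Fin r → ℤ), ∀ g : GL (Fin n) ℂ,
    g ∈ T ↔ ∃ z : Fin r → ℂˣ, g = P * diagHom n (fun i => ∏ j, z j ^ a i j) * P⁻¹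

/-- `T` is a maximal torus of `G`: maximal among the tori contained in `G`. -/
def IsMaximalTorus {n : ℕ} (G T : Subgroup (GL (Fin n) ℂ)) : Prop :=
  Maximal (fun T' : Subgroup (GL (Fin n) ℂ) => T' ≤ G ∧ IsTorus T') T

/-- The centralizer `C_G(K)` of a subgroup `K` in `G`. -/
def relCentralizer {n : ℕ} (G K : Subgroup (GL (Fin n) ℂ)) : Subgroup (GL (Fin n) ℂ) :=
  Subgroup.centralizer (K : Set (GL (Fin n) ℂ)) ⊓ G

/-- The normalizer `N_G(K)` of a subgroup `K` in `G`. -/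
def relNormalizer {n : ℕ} (G K : Subgroup (GL (Fin n) ℂ)) : Subgroup (GL (Fin n) ℂ) :=
  Subgroup.normalizer (K : Set (GL (Fin n) ℂ)) ⊓ G

instance relNormalizer_normal {n : ℕ} (G K : Subgroup (GL (Fin n) ℂ)) :
    (K.subgroupOf (relNormalizer G K)).Normal := by
  constructor
  rintro ⟨h, hh⟩ hK ⟨g, hg⟩
  exact (Subgroup.mem_normalizer_iff.1 hg.1 h).1 hK

/-- The normalizer `N(H)` of the diagonal torus in the general linear group. -/
noncomputable def diagNormalizer (n : ℕ) : Subgroup (GL (Fin n) ℂ) :=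
  Subgroup.normalizer (diagTorus n : Set (GL (Fin n) ℂ))

instance diagNormalizer_normal (n : ℕ) : ((diagTorus n).subgroupOf (diagNormalizer n)).Normal := by
  constructor
  rintro ⟨h, hh⟩ hK ⟨g, hg⟩
  exact (Subgroup.mem_normalizer_iff.1 hg h).1 hK

/-- The Weyl group `N(H)/H` of the general linear group. -/
abbrev WeylGL (n : ℕ) : Type := diagNormalizer n ⧸ (diagTorus n).subgroupOf (diagNormalizer n)

/-! ### The action of the involution on the Weyl group of the general linear group -/

theorem iota_diagHom (n : ℕ) (d : Fin n → ℂˣ) :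
    iota n (diagHom n d) = diagHom n fun i => (d i.rev)⁻¹ := by
  apply Units.ext
  change antiTranspose (Matrix.diagonal fun i => (((d i)⁻¹ : ℂˣ) : ℂ)) =
    Matrix.diagonal fun i => (((d i.rev)⁻¹ : ℂˣ) : ℂ)
  ext i j
  simp only [antiTranspose, Matrix.of_apply, Matrix.diagonal_apply, Fin.rev_inj]
  by_cases hij : i = j
  · subst hij
    simp
  · rw [if_neg hij, if_neg fun h => hij h.symm]

theorem theta_mem_diagTorus (X : Series) (l : ℕ) {g : GL (Fin (size X l)) ℂ}
    (hg : g ∈ diagTorus (size X l)) : theta X l g ∈ diagTorus (size X l) := by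
  obtain ⟨d, rfl⟩ := hg
  refine ⟨fun i => signEntry X l i * (d i.rev)⁻¹ * (signEntry X l i)⁻¹, ?_⟩
  change _ = signMatrix X l * iota _ (diagHom _ d) * (signMatrix X l)⁻¹
  rw [iota_diagHom, signMatrix, ← map_inv, ← map_mul, ← map_mul]
  rfl

theorem iota_iota (n : ℕ) (g : GL (Fin n) ℂ) : iota n (iota n g) = g := by
  apply Units.ext
  change antiTranspose (antiTranspose (g : Matrix (Fin n) (Fin n) ℂ)) = _
  ext i j
  simp [antiTranspose]

theorem signEntry_rev (X : Series) (l : ℕ) :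
    ∃ e : ℂˣ, ∀ i : Fin (size X l), signEntry X l i * (signEntry X l i.rev)⁻¹ = e := by
  have key : ∀ a b : ℕ, ((-1 : ℂˣ) ^ a) * ((-1 : ℂˣ) ^ b)⁻¹ = (-1) ^ (a + b) := by
    intro a b
    rw [pow_add, ← inv_pow, inv_neg_one]
  cases X with
  | B =>
    refine ⟨1, fun i => ?_⟩
    have hi : (i : ℕ) < 2 * l + 1 := i.2
    have h : (i : ℕ) + (i.rev : ℕ) = 2 * l := by
      have : (i.rev : ℕ) = 2 * l + 1 - (i + 1) := Fin.val_rev i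
      omega
    change (-1) ^ (i : ℕ) * ((-1) ^ (i.rev : ℕ))⁻¹ = _
    rw [key, h, pow_mul, neg_one_sq, one_pow]
  | C =>
    refine ⟨-1, fun i => ?_⟩
    have hi : (i : ℕ) < 2 * l := i.2
    have h : (i : ℕ) + (i.rev : ℕ) = 2 * (l - 1) + 1 := by
      have : (i.rev : ℕ) = 2 * l - (i + 1) := Fin.val_rev i
      omega
    change (-1) ^ (i : ℕ) * ((-1) ^ (i.rev : ℕ))⁻¹ = _
    rw [key, h, pow_succ, pow_mul, neg_one_sq, one_pow, one_mul]
  | D =>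
    refine ⟨1, fun i => ?_⟩
    have hi : (i : ℕ) < 2 * l := i.2
    have hr : (i.rev : ℕ) = 2 * l - (i + 1) := Fin.val_rev i
    have h : (i : ℕ) + (i.rev : ℕ) = 2 * (l - 1) + 1 := by omega
    have h' := key i i.rev
    rw [h, pow_succ, pow_mul, neg_one_sq, one_pow, one_mul] at h'
    change (if (i : ℕ) < l then (-1) ^ (i : ℕ) else -(-1) ^ (i : ℕ)) *
      (if (i.rev : ℕ) < l then (-1) ^ (i.rev : ℕ) else -(-1) ^ (i.rev : ℕ))⁻¹ = (1 : ℂˣ)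
    by_cases hl : (i : ℕ) < l
    · rw [if_pos hl, if_neg (by omega), inv_neg, mul_neg, h', neg_neg]
    · rw [if_neg hl, if_pos (by omega), neg_mul, h', neg_neg]

theorem theta_theta (X : Series) (l : ℕ) (g : GL (Fin (size X l)) ℂ) :
    theta X l (theta X l g) = g := by
  obtain ⟨e, he⟩ := signEntry_rev X l
  have hS : signMatrix X l * iota _ (signMatrix X l) = diagHom _ fun _ => e := by
    rw [signMatrix, iota_diagHom, ← map_mul]
    congr 1
    funext i
    exact he i
  have hc : (diagHom _ fun _ => e) * g = g * diagHom _ fun _ => e := by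
    apply Units.ext
    ext i j
    simp [diagHom, mul_comm]
  change signMatrix X l * iota _ (signMatrix X l * iota _ g * (signMatrix X l)⁻¹) *
    (signMatrix X l)⁻¹ = g
  rw [map_mul, map_mul, map_inv, iota_iota, ← mul_assoc, ← mul_assoc, hS, hc, ← hS]
  group

theorem theta_mem_diagNormalizer (X : Series) (l : ℕ) {g : GL (Fin (size X l)) ℂ}
    (hg : g ∈ diagNormalizer (size X l)) : theta X l g ∈ diagNormalizer (size X l) := by
  have key : ∀ h, h ∈ diagTorus (size X l) ↔ theta X l h ∈ diagTorus (size X l) := fun h =>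
    ⟨theta_mem_diagTorus X l, fun hh => theta_theta X l h ▸ theta_mem_diagTorus X l hh⟩
  refine Subgroup.mem_normalizer_iff.2 fun h => ?_
  rw [key h, Subgroup.mem_normalizer_iff.1 hg, key]
  simp only [map_mul, map_inv, theta_theta]

/-- The automorphism of the normalizer of the diagonal torus induced by `θ_G`. -/
noncomputable def thetaNormalizer (X : Series) (l : ℕ) :
    diagNormalizer (size X l) →* diagNormalizer (size X l) :=
  ((theta X l).comp (diagNormalizer (size X l)).subtype).codRestrict _
    fun g => theta_mem_diagNormalizer X l g.2

/-- The automorphism of the Weyl group of the general linear group induced by `θ_G`. -/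
noncomputable def thetaWeyl (X : Series) (l : ℕ) : WeylGL (size X l) →* WeylGL (size X l) :=
  QuotientGroup.map _ _ (thetaNormalizer X l) fun _ hg => theta_mem_diagTorus X l hg

/-- The `θ_G`-fixed part of the Weyl group of the general linear group. -/
noncomputable def fixedWeyl (X : Series) (l : ℕ) : Subgroup (WeylGL (size X l)) :=
  (thetaWeyl X l).eqLocus (MonoidHom.id _)

/-! ### The root system of a classical group -/

/-- The differential `A ↦ -S_G A^τ S_G⁻¹` of `θ_G` on all matrices. -/
noncomputable def dTheta (X : Series) (l : ℕ) :
    Matrix (Fin (size X l)) (Fin (size X l)) ℂ →ₗ[ℂ] Matrix (Fin (size X l)) (Fin (size X l)) ℂ where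
  toFun A := -((signMatrix X l : Matrix (Fin (size X l)) (Fin (size X l)) ℂ) * antiTranspose A *
    ((signMatrix X l)⁻¹ : GL (Fin (size X l)) ℂ))
  map_add' A B := by
    have : antiTranspose (A + B) = antiTranspose A + antiTranspose B := rfl
    rw [this, mul_add, add_mul, neg_add]
  map_smul' c A := by
    have : antiTranspose (c • A) = c • antiTranspose A := rfl
    simp [this]

/-- The Lie algebra of the classical group: the matrices fixed by the differential of `θ_G`. -/
noncomputable def lieAlg (X : Series) (l : ℕ) :
    Submodule ℂ (Matrix (Fin (size X l)) (Fin (size X l)) ℂ) :=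
  LinearMap.eqLocus (dTheta X l) LinearMap.id

/-- The Cartan subalgebra of the classical Lie algebra: its diagonal matrices. -/
noncomputable def cartan (X : Series) (l : ℕ) :
    Submodule ℂ (Matrix (Fin (size X l)) (Fin (size X l)) ℂ) :=
  lieAlg X l ⊓ LinearMap.range (Matrix.diagonalLinearMap (Fin (size X l)) ℂ ℂ)

/-- The root system `Φ_G` in the dual of the Cartan subalgebra: the nonzero linear forms that
have a nonzero root space in the Lie algebra of `G`. -/
noncomputable def roots (X : Series) (l : ℕ) : Set (Module.Dual ℂ (cartan X l)) :=
  {α | α ≠ 0 ∧ ∃ A ∈ lieAlg X l, A ≠ 0 ∧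
    ∀ h : cartan X l, ⁅(h : Matrix (Fin (size X l)) (Fin (size X l)) ℂ), A⁆ = α h • A}

/-- The group `Aut(Φ_G)`: the linear automorphisms of the dual of the Cartan subalgebra that
map the root system onto itself. -/
noncomputable def rootAut (X : Series) (l : ℕ) :
    Subgroup (Module.Dual ℂ (cartan X l) ≃ₗ[ℂ] Module.Dual ℂ (cartan X l)) where
  carrier := {f | ∀ α, f α ∈ roots X l ↔ α ∈ roots X l}
  one_mem' _ := Iff.rfl
  mul_mem' {f g} hf hg α := (hf (g α)).trans (hg α)
  inv_mem' {f} hf α := by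
    have h := hf (f⁻¹ α)
    rw [← LinearEquiv.mul_apply, mul_inv_cancel, LinearEquiv.coe_one, id] at h
    exact h.symm

/-- The `i`-th diagonal entry as a linear form on the Cartan subalgebra. -/
noncomputable def diagEntry (X : Series) (l : ℕ) (i : Fin (size X l)) : Module.Dual ℂ (cartan X l) where
  toFun h := (h : Matrix (Fin (size X l)) (Fin (size X l)) ℂ) i i
  map_add' _ _ := rfl
  map_smul' _ _ := rfl

/-- The lattice of (differentials of) characters of the maximal torus, which is spanned by the
diagonal entries. -/
noncomputable def charLattice (X : Series) (l : ℕ) : AddSubgroup (Module.Dual ℂ (cartan X l)) :=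
  AddSubgroup.closure (Set.range (diagEntry X l))

end ClassicalTorus

open ClassicalTorus

open ClassicalTorus

namespace ClassicalTorus

variable {n : ℕ} {X : Series} {l : ℕ}

/-! ### Diagonal matrices -/

/-! On diagonal matrices `theta` inverts the entries and reverses their order; the sign matrix drops
out. The torus `splitTorus` contains `regularElement`, with entries `2 ^ (i - rev i)`. These are
pairwise distinct, so whatever commutes with this element is diagonal. This one fact shows that
`splitTorus` is a maximal torus, that its centralizer in `G` is the fixed part of the diagonal
torus, that this centralizer is maximal commutative, and that its normalizer in `G` normalizes the
diagonal torus. Conversely, a torus of diagonal matrices in `G` lies in `splitTorus`, because its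
elements have square roots in it, which kills the sign at the middle index. Hence every `T` in
question equals `splitTorus`.

A `theta`-fixed class of the Weyl group has a `theta`-fixed representative: the obstruction is a
diagonal matrix symmetric under reversal, and it can be removed by solving `t i * t (rev i) = d i`
(`exists_mul_theta_fixed`). This gives `N_G(H_G) / H_G ≃ W^θ`.

For the root system write `ε_i` for `diagEntry`, so that `ε_(rev i) = -ε_i`. The roots are the
nonzero `ε_i - ε_j`, where `j = rev i` is allowed only in type `C` (`mem_roots`). Permutation
matrices commuting with `rev` realize every permutation of the `ε_i` compatible with signs, so an
automorphism lies in the image once it permutes the `ε_i` (`mem_range_weylAction`). If there are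
roots, the sum of `α ⊗ α` over them is invariant under `Aut(Φ)` and, by its symmetry under signed
permutations, is a nonzero multiple of the standard form; so automorphisms are isometries
(`weightForm_map`). As the vectors of norm 1 in the character lattice are exactly the nonzero `ε_i`,
automorphisms preserving the lattice permute the `ε_i`.

The lattice condition is automatic outside `D_1` and `D_4`. In type `B` the nonzero `ε_i` are roots;
in type `C` the `2ε_i` are the roots of norm 4; in type `D` each `2ε_i` is a sum of two orthogonal
roots, and for rank other than 4 a parity argument shows that its image has the same shape. -/

theorem diagHom_val (d : Fin n → ℂˣ) :
    (diagHom n d : Matrix (Fin n) (Fin n) ℂ) = Matrix.diagonal fun i => (d i : ℂ) := rfl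

theorem diagHom_injective : Function.Injective (diagHom n) := by
  intro a b h
  funext i
  have := congrArg (fun g : GL (Fin n) ℂ => (g : Matrix (Fin n) (Fin n) ℂ) i i) h
  simpa [diagHom_val, Units.val_inj] using this

theorem mem_diagTorus_iff {g : GL (Fin n) ℂ} :
    g ∈ diagTorus n ↔ ∀ i j, i ≠ j → (g : Matrix (Fin n) (Fin n) ℂ) i j = 0 := by
  constructor
  · rintro ⟨d, rfl⟩ i j hij
    rw [diagHom_val, Matrix.diagonal_apply_ne _ hij]
  · intro h
    have hg : (g : Matrix (Fin n) (Fin n) ℂ) =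
        Matrix.diagonal fun i => (g : Matrix (Fin n) (Fin n) ℂ) i i := by
      ext i j
      by_cases hij : i = j
      · subst hij; simp
      · rw [h i j hij, Matrix.diagonal_apply_ne _ hij]
    have hdet : (g : Matrix (Fin n) (Fin n) ℂ).det ≠ 0 :=
      ((Matrix.isUnit_iff_isUnit_det _).1 g.isUnit).ne_zero
    rw [hg, Matrix.det_diagonal, Finset.prod_ne_zero_iff] at hdet
    refine ⟨fun i => Units.mk0 _ (hdet i (Finset.mem_univ i)), Units.ext ?_⟩
    rw [diagHom_val]
    exact hg.symm

theorem apply_eq_zero_of_commute_diagonal {A : Matrix (Fin n) (Fin n) ℂ} {d : Fin n → ℂ}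
    (hd : Function.Injective d) (h : A * Matrix.diagonal d = Matrix.diagonal d * A)
    {i j : Fin n} (hij : i ≠ j) : A i j = 0 := by
  have := congrFun (congrFun h i) j
  rw [Matrix.mul_diagonal, Matrix.diagonal_mul] at this
  have h0 : (d i - d j) * A i j = 0 := by linear_combination -this
  exact (mul_eq_zero.1 h0).resolve_left (sub_ne_zero.2 fun e => hij (hd e))

theorem diagTorus_commute {g h : GL (Fin n) ℂ} (hg : g ∈ diagTorus n) (hh : h ∈ diagTorus n) :
    g * h = h * g := by
  obtain ⟨a, rfl⟩ := hg
  obtain ⟨b, rfl⟩ := hh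
  rw [← map_mul, ← map_mul, mul_comm]

/-- An integer weight that is injective and odd under the reversal of indices. -/
theorem oddWeight_injective : Function.Injective fun i : Fin n => ((i : ℤ) - (i.rev : ℤ)) := by
  intro i j h
  have hi := Fin.val_rev i
  have hj := Fin.val_rev j
  ext
  dsimp only at h
  omega

/-- A diagonal element with pairwise distinct entries that is fixed by all classical involutions. -/
noncomputable def regularElement (n : ℕ) : GL (Fin n) ℂ :=
  diagHom n fun i => (Units.mk0 (2 : ℂ) two_ne_zero) ^ ((i : ℤ) - (i.rev : ℤ))

theorem mem_diagTorus_of_commute_regularElement {g : GL (Fin n) ℂ}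
    (h : g * regularElement n = regularElement n * g) : g ∈ diagTorus n := by
  refine mem_diagTorus_iff.2 fun i j hij => ?_
  refine apply_eq_zero_of_commute_diagonal (d := fun i : Fin n => (2 : ℂ) ^ ((i : ℤ) - (i.rev : ℤ)))
    ?_ ?_ hij
  · intro i j hij
    refine oddWeight_injective ?_
    -- Taking norms moves the equation to the reals, where integer powers of 2 are strictly
    -- increasing.
    have h2 : (2 : ℝ) ^ ((i : ℤ) - (i.rev : ℤ)) = (2 : ℝ) ^ ((j : ℤ) - (j.rev : ℤ)) := by
      simpa using congrArg norm hij
    exact zpow_right_injective₀ (by norm_num) (by norm_num) h2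
  · have := congrArg Units.val h
    simpa [regularElement, diagHom_val] using this

/-! ### The involution -/

theorem theta_diagHom (d : Fin (size X l) → ℂˣ) :
    theta X l (diagHom _ d) = diagHom _ fun i => (d i.rev)⁻¹ := by
  change signMatrix X l * iota _ (diagHom _ d) * (signMatrix X l)⁻¹ = _
  rw [iota_diagHom, diagTorus_commute (g := signMatrix X l) ⟨_, rfl⟩ ⟨_, rfl⟩, mul_inv_cancel_right]

theorem mem_fixedPart {K : Subgroup (GL (Fin (size X l)) ℂ)} {g : GL (Fin (size X l)) ℂ} :
    g ∈ fixedPart X l K ↔ g ∈ K ∧ theta X l g = g := Iff.rfl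

theorem mem_classicalGroup {g : GL (Fin (size X l)) ℂ} :
    g ∈ classicalGroup X l ↔ theta X l g = g := by
  rw [classicalGroup, mem_fixedPart, and_iff_right (Subgroup.mem_top g)]

theorem theta_diagHom_eq_self {d : Fin (size X l) → ℂˣ} :
    theta X l (diagHom _ d) = diagHom _ d ↔ ∀ i, d i * d i.rev = 1 := by
  rw [theta_diagHom, diagHom_injective.eq_iff, funext_iff]
  refine forall_congr' fun i => ?_
  rw [mul_eq_one_iff_eq_inv, eq_comm]

/-! ### The split maximal torus -/

/-- The diagonal torus `{diag (zᵢ / z_{rev i})}`. -/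
noncomputable def splitTorus (n : ℕ) : Subgroup (GL (Fin n) ℂ) :=
  ((diagHom n).comp
    (MonoidHom.mk' (fun z i => z i / z i.rev : (Fin n → ℂˣ) → Fin n → ℂˣ) fun a b => by
      funext i; simp [mul_div_mul_comm])).range

theorem diagHom_mem_splitTorus {d : Fin n → ℂˣ} :
    diagHom n d ∈ splitTorus n ↔ (∀ i, d i * d i.rev = 1) ∧ ∀ i : Fin n, i.rev = i → d i = 1 := by
  constructor
  · rintro ⟨z, hz⟩
    obtain rfl := diagHom_injective hz
    exact ⟨fun i => by simp, fun i hi => by simp [hi]⟩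
  · rintro ⟨h, hm⟩
    -- The first half of the entries determines the rest, so `z` carries `d` there and is 1
    -- elsewhere.
    refine ⟨fun i => if i < i.rev then d i else 1, ?_⟩
    refine congrArg (diagHom n) (funext fun i => ?_)
    have hi := h i
    rcases lt_trichotomy i i.rev with hlt | heq | hgt
    · simp [hlt, hlt.not_gt]
    · simp [← heq, hm i heq.symm]
    · simpa [hgt, hgt.not_gt] using (eq_inv_of_mul_eq_one_left hi).symm

theorem splitTorus_le_diagTorus : splitTorus n ≤ diagTorus n := by
  rintro _ ⟨z, rfl⟩
  exact ⟨_, rfl⟩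

theorem splitTorus_le_classicalGroup : splitTorus (size X l) ≤ classicalGroup X l := by
  intro g hg
  obtain ⟨d, rfl⟩ := splitTorus_le_diagTorus hg
  exact mem_classicalGroup.2 (theta_diagHom_eq_self.2 (diagHom_mem_splitTorus.1 hg).1)

theorem regularElement_mem_splitTorus : regularElement n ∈ splitTorus n := by
  refine diagHom_mem_splitTorus.2 ⟨fun i => ?_, fun i hi => by simp [hi]⟩
  rw [← zpow_add, Fin.rev_rev]
  simp

theorem isTorus_splitTorus : IsTorus (splitTorus n) := by
  -- The parametrization need not be injective, so `n` parameters serve in place of the true rank.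
  refine ⟨n, 1, fun i => Pi.single i 1 - Pi.single i.rev 1, fun g => ?_⟩
  have key : ∀ (z : Fin n → ℂˣ) (i : Fin n),
      ∏ j, z j ^ ((Pi.single i 1 : Fin n → ℤ) j - (Pi.single i.rev 1 : Fin n → ℤ) j) =
        z i / z i.rev := by
    intro z i
    have hs : ∀ k : Fin n, ∏ j, z j ^ ((Pi.single k 1 : Fin n → ℤ) j) = z k := fun k => by
      rw [Finset.prod_eq_single k] <;> simp +contextual
    simp only [zpow_sub, Finset.prod_mul_distrib, Finset.prod_inv_distrib, hs, div_eq_mul_inv]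
  simp only [Pi.sub_apply, key, one_mul, inv_one, mul_one]
  exact ⟨fun ⟨z, hz⟩ => ⟨z, hz.symm⟩, fun ⟨z, hz⟩ => ⟨z, hz.symm⟩⟩

theorem IsTorus.commute {T : Subgroup (GL (Fin n) ℂ)} (hT : IsTorus T) {g h : GL (Fin n) ℂ}
    (hg : g ∈ T) (hh : h ∈ T) : g * h = h * g := by
  obtain ⟨r, P, a, H⟩ := hT
  obtain ⟨z, rfl⟩ := (H g).1 hg
  obtain ⟨w, rfl⟩ := (H h).1 hh
  rw [conj_mul, conj_mul, diagTorus_commute ⟨_, rfl⟩ ⟨_, rfl⟩]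

theorem exists_units_sq_eq (z : ℂˣ) : ∃ w : ℂˣ, w ^ 2 = z := by
  obtain ⟨w, hw⟩ := IsAlgClosed.exists_pow_nat_eq (z : ℂ) (n := 2) (by norm_num)
  have h0 : w ≠ 0 := by
    rintro rfl
    exact z.ne_zero (by rw [← hw]; simp)
  exact ⟨Units.mk0 w h0, Units.ext (by simpa using hw)⟩

theorem IsTorus.exists_sq_eq {T : Subgroup (GL (Fin n) ℂ)} (hT : IsTorus T) {g : GL (Fin n) ℂ}
    (hg : g ∈ T) : ∃ h ∈ T, h ^ 2 = g := by
  obtain ⟨r, P, a, H⟩ := hT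
  obtain ⟨z, rfl⟩ := (H g).1 hg
  choose w hw using fun j => exists_units_sq_eq (z j)
  refine ⟨_, (H _).2 ⟨w, rfl⟩, ?_⟩
  rw [conj_pow, ← map_pow]
  congr 3
  funext i
  simp only [Pi.pow_apply, ← Finset.prod_pow, ← hw]
  exact Finset.prod_congr rfl fun j _ => by rw [← zpow_natCast, ← zpow_natCast, zpow_comm]

/-- A diagonal element of `G` has middle entry `±1`. An element of a torus is the square of another
element of that torus, so its middle entry is 1. -/
theorem IsTorus.le_splitTorus {T : Subgroup (GL (Fin (size X l)) ℂ)} (hT : IsTorus T)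
    (hG : T ≤ classicalGroup X l) (hD : T ≤ diagTorus (size X l)) : T ≤ splitTorus (size X l) := by
  intro g hg
  obtain ⟨h, hh, rfl⟩ := hT.exists_sq_eq hg
  obtain ⟨d, rfl⟩ := hD hh
  have hd := theta_diagHom_eq_self.1 (mem_classicalGroup.1 (hG hh))
  rw [← map_pow]
  refine diagHom_mem_splitTorus.2 ⟨fun i => ?_, fun i hi => ?_⟩
  · simp only [Pi.pow_apply, ← mul_pow, hd, one_pow]
  · have := hd i
    rw [hi] at this
    rw [Pi.pow_apply, sq, this]

theorem isMaximalTorus_splitTorus :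
    IsMaximalTorus (classicalGroup X l) (splitTorus (size X l)) := by
  refine ⟨⟨splitTorus_le_classicalGroup, isTorus_splitTorus⟩, ?_⟩
  rintro T ⟨hG, hT⟩ hle
  exact hT.le_splitTorus hG fun g hg => mem_diagTorus_of_commute_regularElement
    (hT.commute hg (hle regularElement_mem_splitTorus))

theorem IsMaximalTorus.eq_splitTorus {T : Subgroup (GL (Fin (size X l)) ℂ)}
    (hT : IsMaximalTorus (classicalGroup X l) T) (hD : T ≤ diagTorus (size X l)) :
    T = splitTorus (size X l) :=
  hT.eq_of_le ⟨splitTorus_le_classicalGroup, isTorus_splitTorus⟩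
    (hT.prop.2.le_splitTorus hT.prop.1 hD)

/-! ### Its centralizer -/

theorem relCentralizer_splitTorus :
    relCentralizer (classicalGroup X l) (splitTorus (size X l)) =
      fixedPart X l (diagTorus (size X l)) := by
  ext g
  constructor
  · rintro ⟨hc, hG⟩
    exact ⟨mem_diagTorus_of_commute_regularElement
      (Subgroup.mem_centralizer_iff.1 hc _ regularElement_mem_splitTorus).symm, hG.2⟩
  · rintro ⟨hD, hG⟩
    exact ⟨Subgroup.mem_centralizer_iff.2 fun h hh =>
      diagTorus_commute (splitTorus_le_diagTorus hh) hD, mem_classicalGroup.2 hG⟩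

theorem splitTorus_le_fixedPart :
    splitTorus (size X l) ≤ fixedPart X l (diagTorus (size X l)) := fun _ hg =>
  ⟨splitTorus_le_diagTorus hg, (splitTorus_le_classicalGroup hg).2⟩

theorem maximal_commutative_fixedPart :
    Maximal (fun A : Subgroup (GL (Fin (size X l)) ℂ) =>
      A ≤ classicalGroup X l ∧ IsMulCommutative A) (fixedPart X l (diagTorus (size X l))) := by
  refine ⟨⟨fun g hg => mem_classicalGroup.2 hg.2,
    ⟨⟨fun a b => Subtype.ext (diagTorus_commute a.2.1 b.2.1)⟩⟩⟩, ?_⟩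
  rintro A ⟨hG, hA⟩ hle g hg
  refine ⟨mem_diagTorus_of_commute_regularElement ?_, (hG hg).2⟩
  have := hA.is_comm.comm ⟨g, hg⟩ ⟨_, hle (splitTorus_le_fixedPart regularElement_mem_splitTorus)⟩
  exact congrArg Subtype.val this

theorem rev_ne_self (hX : X ≠ .B) (i : Fin (size X l)) : i.rev ≠ i := by
  intro h
  have h1 := congrArg Fin.val h
  have h2 : (i : ℕ) < size X l := i.2
  rw [Fin.val_rev] at h1
  cases X <;> simp_all [size] <;> omega

theorem fixedPart_diagTorus_of_ne (hX : X ≠ .B) :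
    fixedPart X l (diagTorus (size X l)) = splitTorus (size X l) := by
  refine le_antisymm ?_ splitTorus_le_fixedPart
  rintro _ ⟨⟨d, rfl⟩, hG⟩
  exact diagHom_mem_splitTorus.2 ⟨theta_diagHom_eq_self.1 hG, fun i hi => (rev_ne_self hX i hi).elim⟩

theorem diagHom_neg_one : diagHom n (fun _ => -1) = -1 := by
  apply Units.ext
  ext i j
  simp [diagHom_val, Matrix.diagonal_apply, Matrix.one_apply]
  split_ifs <;> simp

theorem mem_zpowers_neg_one {g : GL (Fin n) ℂ} (hg : g ∈ Subgroup.zpowers (-1)) :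
    g = 1 ∨ g = -1 := by
  obtain ⟨k, rfl⟩ := hg
  rcases Int.even_or_odd k with hk | hk
  · exact Or.inl hk.neg_one_zpow
  · exact Or.inr hk.neg_one_zpow

/-- The middle index in type `B`. -/
def middle (l : ℕ) : Fin (size .B l) := ⟨l, by simp [size]; omega⟩

theorem rev_eq_self_iff {i : Fin (size .B l)} : i.rev = i ↔ i = middle l := by
  have h2 : (i : ℕ) < 2 * l + 1 := i.2
  rw [Fin.ext_iff, Fin.ext_iff, Fin.val_rev]
  simp only [middle, size]
  omega

/-- The middle entry is its own inverse, hence `±1`; if it is `-1`, multiplying by the scalar `-1`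
leads into `splitTorus`. -/
theorem fixedPart_diagTorus_B :
    fixedPart .B l (diagTorus (size .B l)) =
      splitTorus (size .B l) ⊔ Subgroup.zpowers (-1) := by
  apply le_antisymm
  · rintro _ ⟨⟨d, rfl⟩, hG⟩
    have hd := theta_diagHom_eq_self.1 hG
    have hm := hd (middle l)
    rw [rev_eq_self_iff.2 rfl, Units.ext_iff, Units.val_mul, Units.val_one,
      mul_self_eq_one_iff] at hm
    rcases hm with hm | hm
    · refine Subgroup.mem_sup_left (diagHom_mem_splitTorus.2 ⟨hd, fun i hi => ?_⟩)
      rw [rev_eq_self_iff.1 hi]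
      exact Units.ext hm
    · rw [← mul_inv_cancel_right (diagHom _ d) (-1)]
      refine mul_mem (Subgroup.mem_sup_left ?_)
        (Subgroup.mem_sup_right (inv_mem (Subgroup.mem_zpowers _)))
      rw [← diagHom_neg_one, ← map_mul]
      refine diagHom_mem_splitTorus.2 ⟨fun i => by simp [hd], fun i hi => ?_⟩
      rw [rev_eq_self_iff.1 hi]
      exact Units.ext (by simp [hm])
  · refine sup_le splitTorus_le_fixedPart ((Subgroup.zpowers_le).2 ?_)
    rw [← diagHom_neg_one]
    exact ⟨⟨_, rfl⟩, theta_diagHom_eq_self.2 fun i => by simp⟩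

theorem disjoint_splitTorus_zpowers :
    Disjoint (splitTorus (size .B l)) (Subgroup.zpowers (-1)) := by
  rw [Subgroup.disjoint_def]
  intro g hg hz
  refine (mem_zpowers_neg_one hz).resolve_right ?_
  rintro rfl
  rw [← diagHom_neg_one] at hg
  have := (diagHom_mem_splitTorus.1 hg).2 (middle l) (rev_eq_self_iff.2 rfl)
  have h := congrArg Units.val this
  norm_num at h

/-! ### The normalizer of the centralizer of the split torus -/

theorem mem_diagNormalizer_iff {g : GL (Fin n) ℂ} :
    g ∈ diagNormalizer n ↔ ∀ h, h ∈ diagTorus n ↔ g * h * g⁻¹ ∈ diagTorus n :=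
  Subgroup.mem_normalizer_iff

theorem fixedPart_diagNormalizer :
    fixedPart X l (diagNormalizer (size X l)) =
      relNormalizer (classicalGroup X l) (fixedPart X l (diagTorus (size X l))) := by
  ext g
  constructor
  · rintro ⟨hN, hG⟩
    refine ⟨Subgroup.mem_normalizer_iff.2 fun h => ?_, mem_classicalGroup.2 hG⟩
    have hG' : theta X l g = g := hG
    rw [mem_fixedPart, mem_fixedPart, mem_diagNormalizer_iff.1 hN h]
    refine and_congr_right fun _ => ?_
    simp [hG']
  · rintro ⟨hN, hG⟩
    refine ⟨?_, (mem_classicalGroup.1 hG)⟩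
    -- The conjugate of the regular element by `g⁻¹` stays in the fixed part, so it is diagonal and
    -- commutes with `h`. Conjugating back, `g * h * g⁻¹` commutes with the regular element.
    have key : ∀ g ∈ Subgroup.normalizer
        (fixedPart X l (diagTorus (size X l)) : Set (GL (Fin (size X l)) ℂ)),
        ∀ h ∈ diagTorus (size X l), g * h * g⁻¹ ∈ diagTorus (size X l) := by
      intro g hN h hh
      apply mem_diagTorus_of_commute_regularElement
      have hr := (Subgroup.mem_normalizer_iff.1 (inv_mem hN) _).1
        (splitTorus_le_fixedPart (X := X) (l := l) regularElement_mem_splitTorus)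
      have hc := diagTorus_commute hh hr.1
      calc g * h * g⁻¹ * regularElement _
          = g * (h * (g⁻¹ * regularElement _ * g⁻¹⁻¹)) * g⁻¹ := by group
        _ = _ := by rw [hc]; group
    refine mem_diagNormalizer_iff.2 fun h => ⟨key g hN h, fun hh => ?_⟩
    have := key g⁻¹ (inv_mem hN) _ hh
    simpa [mul_assoc] using this

/-! ### The fixed part of the Weyl group -/

theorem mem_fixedWeyl_mk {g : diagNormalizer (size X l)} :
    (QuotientGroup.mk g : WeylGL (size X l)) ∈ fixedWeyl X l ↔
      ((g : GL (Fin (size X l)) ℂ)⁻¹ * theta X l g) ∈ diagTorus (size X l) := by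
  change (QuotientGroup.mk (thetaNormalizer X l g) : WeylGL (size X l)) = QuotientGroup.mk g ↔ _
  rw [eq_comm, QuotientGroup.eq, Subgroup.mem_subgroupOf]
  rfl

theorem relNormalizer_le_diagNormalizer {g : GL (Fin (size X l)) ℂ}
    (hg : g ∈ relNormalizer (classicalGroup X l) (fixedPart X l (diagTorus (size X l)))) :
    g ∈ diagNormalizer (size X l) := by
  rw [← fixedPart_diagNormalizer] at hg
  exact hg.1

/-- The map `N_G(H_G) → W^θ`. -/
noncomputable def toFixedWeyl (X : Series) (l : ℕ) :
    relNormalizer (classicalGroup X l) (fixedPart X l (diagTorus (size X l))) →* fixedWeyl X l :=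
  ((QuotientGroup.mk' _).comp
    (Subgroup.inclusion fun _ => relNormalizer_le_diagNormalizer)).codRestrict _ fun g =>
      mem_fixedWeyl_mk.2 <| by
        rw [Subgroup.coe_inclusion, mem_classicalGroup.1 g.2.2, inv_mul_cancel]
        exact one_mem _

theorem coe_toFixedWeyl
    (g : relNormalizer (classicalGroup X l) (fixedPart X l (diagTorus (size X l)))) :
    (toFixedWeyl X l g : WeylGL (size X l)) =
      QuotientGroup.mk ⟨g, relNormalizer_le_diagNormalizer g.2⟩ := rfl

theorem ker_toFixedWeyl :
    (toFixedWeyl X l).ker = (fixedPart X l (diagTorus (size X l))).subgroupOf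
      (relNormalizer (classicalGroup X l) (fixedPart X l (diagTorus (size X l)))) := by
  ext g
  rw [MonoidHom.mem_ker, Subgroup.mem_subgroupOf, ← Subtype.val_inj, coe_toFixedWeyl,
    OneMemClass.coe_one, QuotientGroup.eq_one_iff, Subgroup.mem_subgroupOf, mem_fixedPart,
    and_iff_left (mem_classicalGroup.1 g.2.2)]

/-- This is the vanishing of a cohomology class of the involution: with `theta g = g * d`, the
element `g * t` is fixed once `t i * t (rev i) = d i`. -/
theorem exists_mul_theta_fixed {g : GL (Fin (size X l)) ℂ}
    (hg : g⁻¹ * theta X l g ∈ diagTorus (size X l)) :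
    ∃ t ∈ diagTorus (size X l), theta X l (g * t) = g * t := by
  obtain ⟨d, hd⟩ := hg
  have hg' : theta X l g = g * diagHom _ d := by rw [hd, mul_inv_cancel_left]
  -- Applying `theta` twice to `g` returns `g`, which forces the symmetry of `d`.
  have hsymm : ∀ i, d i.rev = d i := by
    have h := theta_theta X l g
    rw [hg', map_mul, hg', mul_assoc, mul_eq_left, theta_diagHom, ← map_mul,
      ← map_one (diagHom _), diagHom_injective.eq_iff, funext_iff] at h
    intro i
    have hi := h i
    rw [Pi.mul_apply, Pi.one_apply, mul_inv_eq_one] at hi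
    exact hi.symm
  choose w hw using exists_units_sq_eq
  -- Each pair `i`, `rev i` needs one factor `d i`, placed at the smaller index; a fixed index needs
  -- a square root.
  let t : Fin (size X l) → ℂˣ := fun i => if i < i.rev then d i else if i = i.rev then w (d i) else 1
  have ht : ∀ i, t i * t i.rev = d i := by
    intro i
    rcases lt_trichotomy i i.rev with hlt | heq | hgt
    · simp [t, hlt, hlt.not_gt, hlt.ne']
    · have : t i = w (d i) := by simp only [t, ← heq, lt_irrefl, if_false, if_true]
      rw [← heq, this, ← sq, hw]
    · simp [t, hgt, hgt.not_gt, hgt.ne', hsymm]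
  refine ⟨diagHom _ t, ⟨t, rfl⟩, ?_⟩
  rw [map_mul, hg', mul_assoc, theta_diagHom, ← map_mul]
  congr 2
  funext i
  rw [Pi.mul_apply, ← ht, mul_inv_cancel_right]

theorem exists_relNormalizer_mul {g : diagNormalizer (size X l)}
    (hg : (QuotientGroup.mk g : WeylGL (size X l)) ∈ fixedWeyl X l) :
    ∃ k : relNormalizer (classicalGroup X l) (fixedPart X l (diagTorus (size X l))),
      ∃ t ∈ diagTorus (size X l), (g : GL (Fin (size X l)) ℂ) = k * t ∧
        toFixedWeyl X l k = ⟨QuotientGroup.mk g, hg⟩ := by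
  obtain ⟨t, ht, h⟩ := exists_mul_theta_fixed (mem_fixedWeyl_mk.1 hg)
  have htN : t ∈ diagNormalizer (size X l) := Subgroup.le_normalizer ht
  refine ⟨⟨g * t, ?_⟩, t⁻¹, inv_mem ht, (mul_inv_cancel_right _ _).symm, ?_⟩
  · rw [← fixedPart_diagNormalizer]
    exact ⟨mul_mem g.2 htN, h⟩
  · refine Subtype.ext (Eq.symm ?_)
    rw [coe_toFixedWeyl, QuotientGroup.eq, Subgroup.mem_subgroupOf]
    simpa using ht

theorem toFixedWeyl_surjective : Function.Surjective (toFixedWeyl X l) := by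
  rintro ⟨w, hw⟩
  obtain ⟨g, rfl⟩ := QuotientGroup.mk_surjective w
  obtain ⟨k, _, _, _, hk⟩ := exists_relNormalizer_mul hw
  exact ⟨k, hk⟩

/-- The isomorphism `N_G(H_G) / H_G ≃ W^θ`. -/
noncomputable def quotientEquivFixedWeyl (X : Series) (l : ℕ) :
    (relNormalizer (classicalGroup X l) (fixedPart X l (diagTorus (size X l))) ⧸
      (fixedPart X l (diagTorus (size X l))).subgroupOf
        (relNormalizer (classicalGroup X l) (fixedPart X l (diagTorus (size X l))))) ≃*
      fixedWeyl X l :=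
  (QuotientGroup.quotientMulEquivOfEq ker_toFixedWeyl.symm).trans
    (QuotientGroup.quotientKerEquivOfSurjective (toFixedWeyl X l) toFixedWeyl_surjective)

theorem quotientEquivFixedWeyl_mk
    (g : relNormalizer (classicalGroup X l) (fixedPart X l (diagTorus (size X l)))) :
    quotientEquivFixedWeyl X l (QuotientGroup.mk g) = toFixedWeyl X l g := rfl

/-! ### The Lie algebra and its Cartan subalgebra -/

theorem mem_lieAlg {A : Matrix (Fin (size X l)) (Fin (size X l)) ℂ} :
    A ∈ lieAlg X l ↔ dTheta X l A = A := Iff.rfl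

theorem dTheta_apply (A : Matrix (Fin (size X l)) (Fin (size X l)) ℂ) (i j : Fin (size X l)) :
    dTheta X l A i j =
      -((signEntry X l i : ℂ) * A j.rev i.rev * ((signEntry X l j)⁻¹ : ℂˣ)) := by
  change -((Matrix.diagonal (fun i : Fin (size X l) => (signEntry X l i : ℂ)) * antiTranspose A *
    Matrix.diagonal (fun i : Fin (size X l) => (((signEntry X l i)⁻¹ : ℂˣ) : ℂ))) i j) = _
  rw [Matrix.mul_diagonal, Matrix.diagonal_mul]
  rfl

theorem dTheta_diagonal (d : Fin (size X l) → ℂ) :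
    dTheta X l (Matrix.diagonal d) = Matrix.diagonal fun i => -d i.rev := by
  ext i j
  rw [dTheta_apply]
  by_cases h : i = j
  · subst h
    rw [Matrix.diagonal_apply_eq, Matrix.diagonal_apply_eq, mul_right_comm, Units.mul_inv, one_mul]
  · rw [Matrix.diagonal_apply_ne _ h, Matrix.diagonal_apply_ne _ fun e => h (Fin.rev_inj.1 e).symm]
    simp

theorem mem_cartan {A : Matrix (Fin (size X l)) (Fin (size X l)) ℂ} :
    A ∈ cartan X l ↔ ∃ d : Fin (size X l) → ℂ, (∀ i, d i.rev = -d i) ∧ Matrix.diagonal d = A := by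
  constructor
  · rintro ⟨hA, d, rfl⟩
    refine ⟨d, fun i => ?_, rfl⟩
    have := congrFun (Matrix.diagonal_injective ((dTheta_diagonal d).symm.trans hA)) i
    rw [← this, neg_neg]
  · rintro ⟨d, hd, rfl⟩
    refine ⟨?_, d, rfl⟩
    rw [SetLike.mem_coe, mem_lieAlg, dTheta_diagonal]
    simp [hd]

theorem dTheta_conj (g : GL (Fin (size X l)) ℂ) (A : Matrix (Fin (size X l)) (Fin (size X l)) ℂ) :
    dTheta X l (g.1 * A * (g⁻¹).1) = (theta X l g).1 * dTheta X l A * ((theta X l g)⁻¹).1 := by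
  have h1 : (theta X l g).1 =
      (signMatrix X l).1 * antiTranspose (g⁻¹).1 * ((signMatrix X l)⁻¹).1 := rfl
  have h2 : ((theta X l g)⁻¹).1 =
      (signMatrix X l).1 * antiTranspose g.1 * ((signMatrix X l)⁻¹).1 := by
    rw [← map_inv]
    change _ * antiTranspose (g⁻¹⁻¹).1 * _ = _
    rw [inv_inv]
  rw [h1, h2]
  change -(_ * antiTranspose _ * _) = _ * -((signMatrix X l).1 * antiTranspose A *
    ((signMatrix X l)⁻¹).1) * _
  rw [antiTranspose_mul, antiTranspose_mul, mul_neg, neg_mul]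
  simp only [mul_assoc, Units.inv_mul_cancel_left]

theorem conj_mem_lieAlg {g : GL (Fin (size X l)) ℂ} (hg : g ∈ classicalGroup X l)
    {A : Matrix (Fin (size X l)) (Fin (size X l)) ℂ} (hA : A ∈ lieAlg X l) :
    g.1 * A * (g⁻¹).1 ∈ lieAlg X l := by
  rw [mem_lieAlg, dTheta_conj, mem_classicalGroup.1 hg, mem_lieAlg.1 hA]

theorem diagHom_conj_diagonal (d : Fin n → ℂˣ) (e : Fin n → ℂ) :
    (diagHom n d).1 * Matrix.diagonal e * ((diagHom n d)⁻¹).1 = Matrix.diagonal e := by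
  rw [← map_inv, diagHom_val, diagHom_val, Matrix.diagonal_mul_diagonal,
    Matrix.diagonal_mul_diagonal]
  congr 1
  funext i
  rw [Pi.inv_apply, mul_right_comm, Units.mul_inv, one_mul]

/-- The normalizer is defined through invertible diagonal matrices. Adding a scalar `c` that avoids
all `-d i` makes the matrix invertible, and scalars are unaffected by conjugation. -/
theorem exists_conj_diagonal {g : GL (Fin n) ℂ} (hg : g ∈ diagNormalizer n) (d : Fin n → ℂ) :
    ∃ d' : Fin n → ℂ, g.1 * Matrix.diagonal d * (g⁻¹).1 = Matrix.diagonal d' := by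
  obtain ⟨c, hc⟩ := Infinite.exists_notMem_finset (Finset.univ.image fun i => -d i)
  have hc' : ∀ i, d i + c ≠ 0 := fun i h =>
    hc (Finset.mem_image.2 ⟨i, Finset.mem_univ i, by linear_combination -h⟩)
  obtain ⟨e, he⟩ := (mem_diagNormalizer_iff.1 hg
    (diagHom n fun i => Units.mk0 (d i + c) (hc' i))).1 ⟨_, rfl⟩
  refine ⟨fun i => e i - c, ?_⟩
  have h1 : Matrix.diagonal d = (diagHom n fun i => Units.mk0 (d i + c) (hc' i)).1 -
      c • (1 : Matrix (Fin n) (Fin n) ℂ) := by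
    rw [diagHom_val, Matrix.smul_one_eq_diagonal, Matrix.diagonal_sub]
    simp
  have h2 : (Matrix.diagonal fun i => (e i : ℂ) - c) =
      (diagHom n e).1 - c • (1 : Matrix (Fin n) (Fin n) ℂ) := by
    rw [diagHom_val, Matrix.smul_one_eq_diagonal, Matrix.diagonal_sub]
  rw [h1, h2, he, mul_sub, sub_mul, mul_smul_comm, smul_mul_assoc, mul_one, Units.mul_inv]
  rfl

/-! ### The action on the dual of the Cartan subalgebra -/

/-- The group `N_G(H_G)`. -/
noncomputable abbrev torusNormalizer (X : Series) (l : ℕ) : Subgroup (GL (Fin (size X l)) ℂ) :=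
  relNormalizer (classicalGroup X l) (fixedPart X l (diagTorus (size X l)))

theorem conj_mem_cartan {g : GL (Fin (size X l)) ℂ} (hg : g ∈ torusNormalizer X l)
    {A : Matrix (Fin (size X l)) (Fin (size X l)) ℂ} (hA : A ∈ cartan X l) :
    g.1 * A * (g⁻¹).1 ∈ cartan X l := by
  obtain ⟨hL, d, rfl⟩ := hA
  obtain ⟨d', hd'⟩ := exists_conj_diagonal (relNormalizer_le_diagNormalizer hg) d
  exact ⟨conj_mem_lieAlg hg.2 hL, d', hd'.symm⟩

/-- The conjugation action of `N_G(H_G)` on the Cartan subalgebra. -/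
noncomputable def conjCartan (X : Series) (l : ℕ) :
    torusNormalizer X l →* Module.End ℂ (cartan X l) where
  toFun g :=
    { toFun := fun A => ⟨g.1.1 * A.1 * (g.1⁻¹).1, conj_mem_cartan g.2 A.2⟩
      map_add' := fun A B => Subtype.ext (by simp [mul_add, add_mul])
      map_smul' := fun c A => Subtype.ext (by simp) }
  map_one' := by ext A : 2; simp
  map_mul' g h := by ext A : 2; simp [mul_assoc]

theorem coe_conjCartan (g : torusNormalizer X l) (A : cartan X l) :
    (conjCartan X l g A : Matrix (Fin (size X l)) (Fin (size X l)) ℂ) =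
      g.1.1 * A.1 * (g.1⁻¹).1 := rfl

theorem conjCartan_inv_apply (g : torusNormalizer X l) (A : cartan X l) :
    conjCartan X l g⁻¹ (conjCartan X l g A) = A := by
  rw [← Module.End.mul_apply, ← map_mul, inv_mul_cancel, map_one, Module.End.one_apply]

/-- The contragredient action of `N_G(H_G)` on the dual of the Cartan subalgebra. -/
noncomputable def conjDual (X : Series) (l : ℕ) :
    torusNormalizer X l →* (Module.Dual ℂ (cartan X l) ≃ₗ[ℂ] Module.Dual ℂ (cartan X l)) :=
  (LinearMap.GeneralLinearGroup.generalLinearEquiv ℂ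
    (Module.Dual ℂ (cartan X l))).toMonoidHom.comp <| MonoidHom.toHomUnits <|
    { toFun := fun g => (conjCartan X l g⁻¹).dualMap
      map_one' := by rw [inv_one, map_one]; rfl
      map_mul' := fun g h => by rw [mul_inv_rev, map_mul]; rfl }

theorem conjDual_apply (g : torusNormalizer X l) (v : Module.Dual ℂ (cartan X l))
    (A : cartan X l) : conjDual X l g v A = v (conjCartan X l g⁻¹ A) := rfl

theorem conjDual_apply_conjCartan (g : torusNormalizer X l) (v : Module.Dual ℂ (cartan X l))
    (A : cartan X l) : conjDual X l g v (conjCartan X l g A) = v A := by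
  rw [conjDual_apply, conjCartan_inv_apply]

theorem conjDual_mem_roots (g : torusNormalizer X l) {v : Module.Dual ℂ (cartan X l)}
    (hv : v ∈ roots X l) : conjDual X l g v ∈ roots X l := by
  obtain ⟨h0, A, hA, hA0, h⟩ := hv
  refine ⟨fun e => h0 ((conjDual X l g).map_eq_zero_iff.1 e), g.1.1 * A * (g.1⁻¹).1,
    conj_mem_lieAlg g.2.2 hA, fun e => hA0 ?_, fun B => ?_⟩
  · have := congrArg (fun M => (g.1⁻¹).1 * M * g.1.1) e
    simpa [mul_assoc] using this
  · have hB := h (conjCartan X l g⁻¹ B)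
    rw [← conjDual_apply] at hB
    rw [← smul_mul_assoc, ← mul_smul_comm, ← hB, coe_conjCartan]
    simp only [Ring.lie_def, mul_sub, sub_mul, mul_assoc, Subgroup.coe_inv, inv_inv,
      Units.mul_inv_cancel_left, Units.mul_inv, mul_one]

theorem conjDual_mem_rootAut (g : torusNormalizer X l) : conjDual X l g ∈ rootAut X l := by
  refine fun v => ⟨fun h => ?_, conjDual_mem_roots g⟩
  have := conjDual_mem_roots g⁻¹ h
  rwa [map_inv, ← LinearEquiv.mul_apply, inv_mul_cancel] at this

theorem conjDual_eq_one_of_mem {g : torusNormalizer X l}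
    (hg : (g : GL (Fin (size X l)) ℂ) ∈ diagTorus (size X l)) : conjDual X l g = 1 := by
  ext v A
  rw [conjDual_apply]
  change v _ = v A
  congr 1
  obtain ⟨d, hd⟩ := inv_mem hg
  obtain ⟨e, -, he⟩ := mem_cartan.1 A.2
  refine Subtype.ext ?_
  rw [coe_conjCartan, ← he]
  change (g.1⁻¹).1 * _ * (g.1⁻¹⁻¹).1 = _
  rw [← hd, diagHom_conj_diagonal]

/-- Trivial action on the dual means trivial action on the Cartan subalgebra, which contains the
matrix with pairwise distinct entries `i - rev i`; an element commuting with that matrix is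
diagonal. -/
theorem mem_diagTorus_of_conjDual_eq_one {g : torusNormalizer X l} (hg : conjDual X l g = 1) :
    (g : GL (Fin (size X l)) ℂ) ∈ diagTorus (size X l) := by
  have hA : Matrix.diagonal (fun i : Fin (size X l) => (((i : ℤ) - (i.rev : ℤ) : ℤ) : ℂ)) ∈
      cartan X l := mem_cartan.2 ⟨_, fun i => by rw [Fin.rev_rev]; push_cast; ring, rfl⟩
  refine mem_diagTorus_iff.2 fun i j hij => apply_eq_zero_of_commute_diagonal
    (d := fun i : Fin (size X l) => (((i : ℤ) - (i.rev : ℤ) : ℤ) : ℂ)) (Int.cast_injective.comp oddWeight_injective) ?_ hij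
  have h : conjCartan X l g ⟨_, hA⟩ = ⟨_, hA⟩ := by
    refine (Module.forall_dual_apply_eq_zero_iff ℂ _).1 ?_ |> sub_eq_zero.1
    intro v
    have := conjDual_apply_conjCartan g v ⟨_, hA⟩
    rw [hg] at this
    rw [map_sub, ← this]
    exact sub_self _
  have h' := congrArg (fun M => M * g.1.1) (congrArg Subtype.val h)
  simpa [coe_conjCartan, mul_assoc] using h'

/-- The action of `N_G(H_G)` by automorphisms of the root system. -/
noncomputable def conjRootAut (X : Series) (l : ℕ) : torusNormalizer X l →* rootAut X l :=
  (conjDual X l).codRestrict (rootAut X l) conjDual_mem_rootAut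

theorem le_ker_conjRootAut : (fixedPart X l (diagTorus (size X l))).subgroupOf
    (torusNormalizer X l) ≤ (conjRootAut X l).ker := by
  intro g hg
  exact Subtype.ext (conjDual_eq_one_of_mem (mem_fixedPart.1 (Subgroup.mem_subgroupOf.1 hg)).1)

/-- The action of `W^θ` on the dual of the Cartan subalgebra, with values in `Aut(Φ_G)`. -/
noncomputable def weylAction (X : Series) (l : ℕ) : fixedWeyl X l →* rootAut X l :=
  (QuotientGroup.lift _ (conjRootAut X l) le_ker_conjRootAut).comp
    (quotientEquivFixedWeyl X l).symm.toMonoidHom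

theorem weylAction_toFixedWeyl (g : torusNormalizer X l) :
    (weylAction X l (toFixedWeyl X l g) :
      Module.Dual ℂ (cartan X l) ≃ₗ[ℂ] Module.Dual ℂ (cartan X l)) = conjDual X l g := by
  rw [← quotientEquivFixedWeyl_mk]
  change ((QuotientGroup.lift _ (conjRootAut X l) le_ker_conjRootAut
    ((quotientEquivFixedWeyl X l).symm _) : rootAut X l) :
      Module.Dual ℂ (cartan X l) ≃ₗ[ℂ] Module.Dual ℂ (cartan X l)) = _
  rw [MulEquiv.symm_apply_apply]
  rfl

theorem weylAction_injective : Function.Injective (weylAction X l) := by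
  refine (injective_iff_map_eq_one _).2 fun w hw => ?_
  obtain ⟨g, rfl⟩ := toFixedWeyl_surjective w
  have h := congrArg Subtype.val hw
  rw [weylAction_toFixedWeyl] at h
  rw [← MonoidHom.mem_ker, ker_toFixedWeyl, Subgroup.mem_subgroupOf]
  exact ⟨mem_diagTorus_of_conjDual_eq_one h, mem_classicalGroup.1 g.2.2⟩

/-- The representative `g` need not lie in `G`. It differs from one that does by a diagonal factor,
which acts trivially on diagonal matrices. -/
theorem weylAction_apply (g : diagNormalizer (size X l))
    (hg : (QuotientGroup.mk g : WeylGL (size X l)) ∈ fixedWeyl X l) (A : cartan X l) :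
    ∃ hA : g.1.1 * A.1 * (g.1⁻¹).1 ∈ cartan X l, ∀ v : Module.Dual ℂ (cartan X l),
      (weylAction X l ⟨QuotientGroup.mk g, hg⟩ : Module.Dual ℂ (cartan X l) ≃ₗ[ℂ]
        Module.Dual ℂ (cartan X l)) v ⟨_, hA⟩ = v A := by
  obtain ⟨k, t, ⟨d, rfl⟩, hgk, hk⟩ := exists_relNormalizer_mul hg
  have hconj : g.1.1 * A.1 * (g.1⁻¹).1 = (conjCartan X l k A).1 := by
    obtain ⟨e, -, he⟩ := mem_cartan.1 A.2
    have : (diagHom _ d).1 * A.1 * ((diagHom _ d)⁻¹).1 = A.1 := by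
      rw [← he, diagHom_conj_diagonal]
    rw [coe_conjCartan, hgk, mul_inv_rev, Units.val_mul, Units.val_mul]
    nth_rw 2 [← this]
    simp only [mul_assoc]
  refine ⟨hconj ▸ (conjCartan X l k A).2, fun v => ?_⟩
  have : (⟨g.1.1 * A.1 * (g.1⁻¹).1, hconj ▸ (conjCartan X l k A).2⟩ : cartan X l) =
    conjCartan X l k A := Subtype.ext hconj
  rw [this, ← hk, weylAction_toFixedWeyl, conjDual_apply_conjCartan]

/-! ### The weights and the coweights -/

theorem coe_apply_rev (A : cartan X l) (i : Fin (size X l)) :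
    A.1 i.rev i.rev = -A.1 i i := by
  obtain ⟨d, hd, h⟩ := mem_cartan.1 A.2
  rw [← h, Matrix.diagonal_apply_eq, Matrix.diagonal_apply_eq, hd]

theorem diagEntry_apply (i : Fin (size X l)) (A : cartan X l) : diagEntry X l i A = A.1 i i := rfl

theorem diagEntry_rev (i : Fin (size X l)) : diagEntry X l i.rev = -diagEntry X l i :=
  LinearMap.ext fun A => coe_apply_rev A i

theorem cartan_ext {A B : cartan X l} (h : ∀ i, A.1 i i = B.1 i i) : A = B := by
  obtain ⟨d, -, hd⟩ := mem_cartan.1 A.2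
  obtain ⟨e, -, he⟩ := mem_cartan.1 B.2
  refine Subtype.ext ?_
  rw [← hd, ← he]
  congr 1
  funext i
  simpa [← hd, ← he] using h i

/-- The coweight `E_{kk} - E_{rev k, rev k}`. -/
noncomputable def coweight (X : Series) (l : ℕ) (k : Fin (size X l)) : cartan X l :=
  ⟨Matrix.diagonal fun i => (if i = k then 1 else 0) - if i = k.rev then 1 else 0,
    mem_cartan.2 ⟨_, fun i => by simp [Fin.rev_eq_iff], rfl⟩⟩

theorem diagEntry_coweight (i k : Fin (size X l)) :
    diagEntry X l i (coweight X l k) = (if i = k then 1 else 0) - if i = k.rev then 1 else 0 := by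
  change Matrix.diagonal _ i i = _
  rw [Matrix.diagonal_apply_eq]

theorem coweight_rev (k : Fin (size X l)) : coweight X l k.rev = -coweight X l k := by
  refine cartan_ext fun i => ?_
  have h1 := diagEntry_coweight i k
  have h2 := diagEntry_coweight i k.rev
  rw [diagEntry_apply] at h1 h2
  rw [h2, Submodule.coe_neg, Matrix.neg_apply, h1, Fin.rev_rev, neg_sub]

/-- The indices `k` and `rev k` contribute the same term, since entry and coweight both change sign;
hence the factor `1/2`. -/
theorem eq_sum_coweight (A : cartan X l) :
    A = (1 / 2 : ℂ) • ∑ k, A.1 k k • coweight X l k := by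
  refine cartan_ext fun i => ?_
  rw [← diagEntry_apply, ← diagEntry_apply, map_smul, map_sum]
  simp only [map_smul, diagEntry_coweight, smul_eq_mul, mul_sub, mul_ite, mul_one, mul_zero,
    Finset.sum_sub_distrib, Finset.sum_ite_eq, Finset.mem_univ, if_true]
  rw [Finset.sum_congr rfl fun k _ => if_congr (Fin.rev_eq_iff.symm.trans eq_comm : i = k.rev ↔ k = i.rev) rfl rfl]
  rw [Finset.sum_ite_eq' Finset.univ i.rev, if_pos (Finset.mem_univ _), coe_apply_rev,
    diagEntry_apply]
  ring

theorem dual_ext {v w : Module.Dual ℂ (cartan X l)}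
    (h : ∀ k, v (coweight X l k) = w (coweight X l k)) : v = w := by
  refine LinearMap.ext fun A => ?_
  rw [eq_sum_coweight A]
  simp only [map_smul, map_sum, h]

theorem eq_sum_diagEntry (v : Module.Dual ℂ (cartan X l)) :
    v = (1 / 2 : ℂ) • ∑ k, v (coweight X l k) • diagEntry X l k := by
  refine LinearMap.ext fun A => ?_
  conv_lhs => rw [eq_sum_coweight A]
  simp [diagEntry_apply, mul_comm]

theorem diagEntry_eq_zero_iff {i : Fin (size X l)} : diagEntry X l i = 0 ↔ i.rev = i := by
  constructor
  · intro h
    have := LinearMap.congr_fun h (coweight X l i)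
    rw [diagEntry_coweight, if_pos rfl] at this
    by_contra hne
    rw [if_neg (Ne.symm hne)] at this
    simp at this
  · intro h
    have := diagEntry_rev i
    rw [h] at this
    refine dual_ext fun k => ?_
    exact self_eq_neg.1 (LinearMap.congr_fun this (coweight X l k))

theorem diagEntry_injective : Function.Injective (diagEntry X l) := by
  intro i j h
  by_contra hij
  have h1 := congrArg (fun v => v (coweight X l i)) h
  have h2 := congrArg (fun v => v (coweight X l j)) h
  simp only [diagEntry_coweight, if_true, if_neg hij, if_neg (Ne.symm hij)] at h1 h2
  by_cases h3 : i = i.rev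
  · have h4 : j ≠ j.rev := fun h4 => hij <| by
      have h5 := congrArg Fin.val h3
      have h6 := congrArg Fin.val h4
      rw [Fin.val_rev] at h5 h6
      ext; omega
    rw [if_neg h4] at h2
    split_ifs at h2 <;> norm_num at h2
  · rw [if_neg h3] at h1
    split_ifs at h1 <;> norm_num at h1

/-! ### The invariant form -/

/-- The linear map `h* → h` that takes `εᵢ` to the `i`-th coweight. -/
noncomputable def sharp (X : Series) (l : ℕ) : Module.Dual ℂ (cartan X l) →ₗ[ℂ] cartan X l where
  toFun v := (1 / 2 : ℂ) • ∑ k, v (coweight X l k) • coweight X l k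
  map_add' v w := by simp [add_smul, Finset.sum_add_distrib]
  map_smul' c v := by simp [mul_smul, Finset.smul_sum, smul_comm _ c]

theorem sharp_diagEntry (i : Fin (size X l)) : sharp X l (diagEntry X l i) = coweight X l i := by
  conv_rhs => rw [eq_sum_coweight (coweight X l i)]
  change (1 / 2 : ℂ) • ∑ k, diagEntry X l i (coweight X l k) • coweight X l k = _
  congr 1
  refine Finset.sum_congr rfl fun k _ => ?_
  rw [← diagEntry_apply, diagEntry_coweight, diagEntry_coweight]
  congr 2
  · exact if_congr eq_comm rfl rfl
  · exact if_congr (Fin.rev_eq_iff.symm.trans eq_comm) rfl rfl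

/-- The symmetric bilinear form on the dual of the Cartan subalgebra for which the weights are
orthonormal up to sign. -/
noncomputable def weightForm (v w : Module.Dual ℂ (cartan X l)) : ℂ := v (sharp X l w)

theorem weightForm_diagEntry_right (v : Module.Dual ℂ (cartan X l)) (i : Fin (size X l)) :
    weightForm v (diagEntry X l i) = v (coweight X l i) := by
  rw [weightForm, sharp_diagEntry]

theorem weightForm_diagEntry (i j : Fin (size X l)) :
    weightForm (diagEntry X l i) (diagEntry X l j) =
      (if i = j then 1 else 0) - if i = j.rev then 1 else 0 := by
  rw [weightForm_diagEntry_right, diagEntry_coweight]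

theorem weightForm_add_left (u v w : Module.Dual ℂ (cartan X l)) :
    weightForm (u + v) w = weightForm u w + weightForm v w := rfl

theorem weightForm_sub_left (u v w : Module.Dual ℂ (cartan X l)) :
    weightForm (u - v) w = weightForm u w - weightForm v w := rfl

theorem weightForm_sub_right (u v w : Module.Dual ℂ (cartan X l)) :
    weightForm u (v - w) = weightForm u v - weightForm u w := by
  rw [weightForm, map_sub, map_sub]; rfl

/-! ### The roots -/

theorem lie_eq_smul_iff {α : Module.Dual ℂ (cartan X l)}
    {A : Matrix (Fin (size X l)) (Fin (size X l)) ℂ} :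
    (∀ h : cartan X l, ⁅(h : Matrix (Fin (size X l)) (Fin (size X l)) ℂ), A⁆ = α h • A) ↔
      ∀ i j, A i j ≠ 0 → α = diagEntry X l i - diagEntry X l j := by
  have key : ∀ (h : cartan X l) (i j),
      ⁅(h : Matrix (Fin (size X l)) (Fin (size X l)) ℂ), A⁆ i j =
        (diagEntry X l i - diagEntry X l j) h * A i j := by
    intro h i j
    obtain ⟨d, -, hd⟩ := mem_cartan.1 h.2
    rw [LinearMap.sub_apply, diagEntry_apply, diagEntry_apply, ← hd, Ring.lie_def, Matrix.sub_apply,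
      Matrix.diagonal_mul, Matrix.mul_diagonal, Matrix.diagonal_apply_eq, Matrix.diagonal_apply_eq]
    ring
  constructor
  · intro H i j hij
    refine LinearMap.ext fun h => mul_right_cancel₀ hij ?_
    rw [← key, H h]
    rfl
  · intro H h
    ext i j
    rw [key, Matrix.smul_apply, smul_eq_mul]
    by_cases hij : A i j = 0
    · rw [hij, mul_zero, mul_zero]
    · rw [H i j hij]

theorem neg_one_pow_eq_neg {a b : ℕ} (h : Odd (a + b)) : (-1 : ℂˣ) ^ a = -(-1) ^ b := by
  rcases Nat.even_or_odd a with ha | ha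
  · rw [ha.neg_one_pow, ((Nat.odd_add'.1 h).2 ha).neg_one_pow, neg_neg]
  · rw [ha.neg_one_pow, ((Nat.odd_add.1 h).1 ha).neg_one_pow]

theorem signEntry_rev_of_ne (hX : X ≠ .C) (i : Fin (size X l)) :
    signEntry X l i.rev = signEntry X l i := by
  have hi := i.2
  have hr := Fin.val_rev i
  generalize (i.rev : ℕ) = b at *
  generalize (i : ℕ) = a at *
  cases X with
  | B =>
    change a < 2 * l + 1 at hi
    change b = 2 * l + 1 - (a + 1) at hr
    refine neg_one_pow_congr ?_
    rw [Nat.even_iff, Nat.even_iff]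
    omega
  | C => exact absurd rfl hX
  | D =>
    change a < 2 * l at hi
    change b = 2 * l - (a + 1) at hr
    have h : (-1 : ℂˣ) ^ b = -(-1) ^ a := neg_one_pow_eq_neg (by rw [Nat.odd_iff]; omega)
    simp only [signEntry, h, neg_neg]
    split_ifs <;> first | omega | rfl

theorem signEntry_rev_C (i : Fin (size .C l)) :
    signEntry .C l i.rev = -signEntry .C l i := by
  have hi : (i : ℕ) < 2 * l := i.2
  have hr : (i.rev : ℕ) = 2 * l - (i + 1) := Fin.val_rev i
  exact neg_one_pow_eq_neg (by rw [Nat.odd_iff]; omega)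

theorem dTheta_dTheta (A : Matrix (Fin (size X l)) (Fin (size X l)) ℂ) :
    dTheta X l (dTheta X l A) = A := by
  ext i j
  obtain ⟨e, he⟩ := signEntry_rev X l
  rw [dTheta_apply, dTheta_apply, Fin.rev_rev, Fin.rev_rev]
  have h : ((signEntry X l i * (signEntry X l i.rev)⁻¹ : ℂˣ) : ℂ) *
      ((signEntry X l j * (signEntry X l j.rev)⁻¹)⁻¹ : ℂˣ) = 1 := by
    rw [he, he, Units.mul_inv]
  rw [mul_inv_rev, inv_inv, Units.val_mul, Units.val_mul] at h
  linear_combination A i j * h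

/-- A root vector with a nonzero entry at `(i, j)` has root `ε_i - ε_j`. Conversely `E_ij + dTheta
E_ij` is a root vector unless it vanishes, which happens only on the antidiagonal when the signs are
symmetric under reversal (types `B` and `D`). -/
theorem mem_roots {α : Module.Dual ℂ (cartan X l)} :
    α ∈ roots X l ↔ α ≠ 0 ∧ ∃ i j, (j ≠ i.rev ∨ X = .C) ∧
      α = diagEntry X l i - diagEntry X l j := by
  refine and_congr_right fun h0 => ?_
  simp only [lie_eq_smul_iff]
  constructor
  · rintro ⟨A, hA, hA0, h⟩
    obtain ⟨i, j, hij⟩ : ∃ i j, A i j ≠ 0 := by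
      by_contra! hc
      exact hA0 (Matrix.ext hc)
    refine ⟨i, j, ?_, h i j hij⟩
    by_contra! hc
    obtain ⟨rfl, hX⟩ := hc
    have h1 := congrFun (congrFun (mem_lieAlg.1 hA) i) i.rev
    rw [dTheta_apply, Fin.rev_rev, signEntry_rev_of_ne hX, mul_right_comm, Units.mul_inv,
      one_mul] at h1
    exact hij (self_eq_neg.1 h1.symm)
  · rintro ⟨i, j, hij, rfl⟩
    have hE : ∀ a b, Matrix.single i j (1 : ℂ) a b ≠ 0 → i = a ∧ j = b := by
      intro a b hab
      by_contra hc
      exact hab (Matrix.single_apply_of_ne _ _ _ _ _ hc)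
    refine ⟨Matrix.single i j 1 + dTheta X l (Matrix.single i j 1), ?_, fun h => ?_, ?_⟩
    · rw [mem_lieAlg, map_add, dTheta_dTheta, add_comm]
    · have h1 := congrFun (congrFun h i) j
      rw [Matrix.add_apply, Matrix.single_apply_same, dTheta_apply, Matrix.zero_apply] at h1
      by_cases hji : j = i.rev
      · obtain rfl := hij.resolve_left (not_not.2 hji)
        subst hji
        rw [Fin.rev_rev, Matrix.single_apply_same, signEntry_rev_C, mul_one, inv_neg, Units.val_neg,
          mul_neg, Units.mul_inv] at h1
        norm_num at h1
      · rw [Matrix.single_apply_of_ne _ _ _ _ _ fun hc => hji hc.2] at h1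
        simp at h1
    · intro a b hab
      by_cases h1 : Matrix.single i j (1 : ℂ) a b = 0
      · rw [Matrix.add_apply, h1, zero_add, dTheta_apply] at hab
        have h2 : Matrix.single i j (1 : ℂ) b.rev a.rev ≠ 0 := by
          rintro h2
          rw [h2] at hab
          simp at hab
        obtain ⟨rfl, rfl⟩ := hE _ _ h2
        rw [diagEntry_rev, diagEntry_rev]
        abel
      · obtain ⟨rfl, rfl⟩ := hE _ _ h1
        rfl

theorem finite_roots : (roots X l).Finite := by
  refine (Set.finite_range fun p : Fin (size X l) × Fin (size X l) =>
    diagEntry X l p.1 - diagEntry X l p.2).subset fun α hα => ?_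
  obtain ⟨-, i, j, -, rfl⟩ := mem_roots.1 hα
  exact ⟨(i, j), rfl⟩

/-! ### Permutation matrices -/

/-- The permutation matrix that takes the `j`-th basis vector to the `σ j`-th one. -/
noncomputable def permGL (σ : Equiv.Perm (Fin n)) : GL (Fin n) ℂ where
  val := Matrix.of fun i j => if i = σ j then 1 else 0
  inv := Matrix.of fun i j => if σ i = j then 1 else 0
  val_inv := by
    ext i j
    rw [Matrix.mul_apply, ← Equiv.sum_comp σ.symm]
    simp [Matrix.one_apply]
  inv_val := by
    ext i j
    simp [Matrix.mul_apply, Matrix.one_apply]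

theorem permGL_apply (σ : Equiv.Perm (Fin n)) (i j : Fin n) :
    (permGL σ).1 i j = if i = σ j then 1 else 0 := rfl

theorem permGL_inv_apply (σ : Equiv.Perm (Fin n)) (i j : Fin n) :
    ((permGL σ)⁻¹).1 i j = if σ i = j then 1 else 0 := rfl

theorem permGL_conj_apply (σ : Equiv.Perm (Fin n)) (A : Matrix (Fin n) (Fin n) ℂ) (i j : Fin n) :
    ((permGL σ).1 * A * ((permGL σ)⁻¹).1) (σ i) (σ j) = A i j := by
  simp [Matrix.mul_apply, permGL_apply, permGL_inv_apply, -Matrix.coe_units_inv]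

theorem permGL_mem_diagNormalizer (σ : Equiv.Perm (Fin n)) : permGL σ ∈ diagNormalizer n := by
  refine mem_diagNormalizer_iff.2 fun h => ?_
  rw [mem_diagTorus_iff, mem_diagTorus_iff]
  constructor
  · intro H i j hij
    have := permGL_conj_apply σ h.1 (σ.symm i) (σ.symm j)
    rw [σ.apply_symm_apply, σ.apply_symm_apply] at this
    exact this.trans (H _ _ fun e => hij (σ.symm.injective e))
  · intro H i j hij
    rw [← permGL_conj_apply σ h.1]
    exact H _ _ fun e => hij (σ.injective e)

theorem theta_apply (g : GL (Fin (size X l)) ℂ) (i j : Fin (size X l)) :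
    (theta X l g).1 i j =
      (signEntry X l i : ℂ) * (g⁻¹).1 j.rev i.rev * ((signEntry X l j)⁻¹ : ℂˣ) := by
  change (Matrix.diagonal (fun i : Fin (size X l) => (signEntry X l i : ℂ)) *
    antiTranspose (g⁻¹).1 *
      Matrix.diagonal (fun i : Fin (size X l) => (((signEntry X l i)⁻¹ : ℂˣ) : ℂ))) i j = _
  rw [Matrix.mul_diagonal, Matrix.diagonal_mul]
  rfl

/-- The permutation matrix itself may fail to be fixed by `theta`, but the failure is a diagonal
matrix of signs. -/
theorem permGL_mem_fixedWeyl {σ : Equiv.Perm (Fin (size X l))} (hσ : ∀ i, σ i.rev = (σ i).rev) :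
    (QuotientGroup.mk ⟨permGL σ, permGL_mem_diagNormalizer σ⟩ : WeylGL (size X l)) ∈
      fixedWeyl X l := by
  rw [mem_fixedWeyl_mk, mem_diagTorus_iff]
  intro i j hij
  simp [Matrix.mul_apply, theta_apply, permGL_inv_apply, hσ, hij, -Matrix.coe_units_inv]

theorem diagEntry_perm_coweight_perm {σ : Equiv.Perm (Fin (size X l))}
    (hσ : ∀ i, σ i.rev = (σ i).rev) (i k : Fin (size X l)) :
    diagEntry X l (σ i) (coweight X l (σ k)) = diagEntry X l i (coweight X l k) := by
  simp only [diagEntry_coweight, ← hσ, σ.injective.eq_iff]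

theorem exists_weylAction_diagEntry {σ : Equiv.Perm (Fin (size X l))}
    (hσ : ∀ i, σ i.rev = (σ i).rev) :
    ∃ w : fixedWeyl X l, ∀ i,
      (weylAction X l w : Module.Dual ℂ (cartan X l) ≃ₗ[ℂ] Module.Dual ℂ (cartan X l))
        (diagEntry X l i) = diagEntry X l (σ i) := by
  refine ⟨⟨_, permGL_mem_fixedWeyl hσ⟩, fun i => dual_ext fun k => ?_⟩
  obtain ⟨k, rfl⟩ := σ.surjective k
  obtain ⟨hA, h⟩ := weylAction_apply _ (permGL_mem_fixedWeyl hσ) (coweight X l k)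
  have hk : coweight X l (σ k) = ⟨_, hA⟩ := by
    refine cartan_ext fun j => ?_
    obtain ⟨j, rfl⟩ := σ.surjective j
    refine Eq.trans ?_ (permGL_conj_apply σ _ _ _).symm
    exact diagEntry_perm_coweight_perm hσ j k
  rw [diagEntry_perm_coweight_perm hσ, hk]
  exact h _

/-- Automorphisms of the root system that permute the weights come from the Weyl group. -/
theorem mem_range_weylAction {f : rootAut X l}
    (hf : ∀ i, ∃ j, (f : Module.Dual ℂ (cartan X l) ≃ₗ[ℂ] Module.Dual ℂ (cartan X l))
      (diagEntry X l i) = diagEntry X l j) : f ∈ (weylAction X l).range := by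
  choose τ hτ using hf
  have hinj : Function.Injective τ := fun i j h => by
    refine diagEntry_injective (f.1.injective ?_)
    rw [hτ, hτ, h]
  have hrev : ∀ i, τ i.rev = (τ i).rev := fun i => diagEntry_injective <| by
    rw [← hτ, diagEntry_rev, diagEntry_rev, map_neg, hτ]
  obtain ⟨w, hw⟩ := exists_weylAction_diagEntry
    (σ := Equiv.ofBijective τ (Finite.injective_iff_bijective.1 hinj)) hrev
  refine ⟨w, Subtype.ext (LinearEquiv.ext fun v => ?_)⟩
  rw [eq_sum_diagEntry v]
  simp only [map_smul, map_sum, hw, hτ, Equiv.ofBijective_apply]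

/-! ### Preservation of the character lattice -/

/-- Conjugation takes the idempotent `E_kk` to a diagonal idempotent, whose entries are 0 or 1.
These are the coefficients of the image of `ε_i`, so the permutation behind `g` need not be
extracted. -/
theorem conjDual_diagEntry_mem_charLattice (g : torusNormalizer X l) (i : Fin (size X l)) :
    conjDual X l g (diagEntry X l i) ∈ charLattice X l := by
  have hN := inv_mem (relNormalizer_le_diagNormalizer g.2)
  choose c hc using fun k : Fin (size X l) => exists_conj_diagonal hN (Pi.single k 1)
  have hc01 : ∀ k, c k i = 0 ∨ c k i = 1 := by
    intro k
    have h : Matrix.diagonal (c k) * Matrix.diagonal (c k) = Matrix.diagonal (c k) := by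
      have h1 : Matrix.diagonal (Pi.single k (1 : ℂ)) * Matrix.diagonal (Pi.single k 1) =
          Matrix.diagonal (Pi.single k 1) := by
        rw [Matrix.diagonal_mul_diagonal]
        congr 1
        funext j
        by_cases hj : j = k
        · subst hj; simp
        · simp [hj]
      rw [← hc]
      nth_rw 3 [← h1]
      simp only [mul_assoc, inv_inv, Units.mul_inv_cancel_left]
    rw [Matrix.diagonal_mul_diagonal] at h
    have := congrFun (Matrix.diagonal_injective h) i
    exact or_iff_not_imp_left.2 fun h0 => mul_right_cancel₀ h0 (this.trans (one_mul _).symm)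
  have key : conjDual X l g (diagEntry X l i) = ∑ k, c k i • diagEntry X l k := by
    refine LinearMap.ext fun A => ?_
    obtain ⟨d, -, hd⟩ := mem_cartan.1 A.2
    have hs : A.1 = ∑ k, d k • Matrix.diagonal (Pi.single k (1 : ℂ)) := by
      rw [← hd]
      ext a b
      by_cases hab : a = b
      · subst hab
        simp [Matrix.sum_apply, Pi.single_apply]
      · simp [Matrix.sum_apply, hab]
    rw [conjDual_apply, diagEntry_apply, coe_conjCartan]
    change ((g.1⁻¹).1 * A.1 * (g.1⁻¹⁻¹).1) i i = _
    rw [hs, Finset.mul_sum, Finset.sum_mul, Matrix.sum_apply, LinearMap.sum_apply]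
    refine Finset.sum_congr rfl fun k _ => ?_
    rw [mul_smul_comm, smul_mul_assoc, hc, LinearMap.smul_apply, diagEntry_apply, ← hd]
    simp [mul_comm]
  rw [key]
  refine sum_mem fun k _ => ?_
  rcases hc01 k with h | h <;> rw [h]
  · rw [zero_smul]; exact zero_mem _
  · rw [one_smul]; exact AddSubgroup.subset_closure ⟨k, rfl⟩

theorem conjDual_mem_charLattice (g : torusNormalizer X l) {v : Module.Dual ℂ (cartan X l)}
    (hv : v ∈ charLattice X l) : conjDual X l g v ∈ charLattice X l := by
  induction hv using AddSubgroup.closure_induction with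
  | mem x hx => obtain ⟨i, rfl⟩ := hx; exact conjDual_diagEntry_mem_charLattice g i
  | zero => rw [map_zero]; exact zero_mem _
  | add x y _ _ hx hy => rw [map_add]; exact add_mem hx hy
  | neg x _ hx => rw [map_neg]; exact neg_mem hx

theorem weylAction_mem_charLattice_iff (w : fixedWeyl X l) (v : Module.Dual ℂ (cartan X l)) :
    (weylAction X l w : Module.Dual ℂ (cartan X l) ≃ₗ[ℂ] Module.Dual ℂ (cartan X l)) v ∈
      charLattice X l ↔ v ∈ charLattice X l := by
  obtain ⟨g, rfl⟩ := toFixedWeyl_surjective w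
  rw [weylAction_toFixedWeyl]
  refine ⟨fun h => ?_, conjDual_mem_charLattice g⟩
  have := conjDual_mem_charLattice g⁻¹ h
  rwa [map_inv, ← LinearEquiv.mul_apply, inv_mul_cancel] at this

theorem exists_int_apply_coweight {v : Module.Dual ℂ (cartan X l)} (hv : v ∈ charLattice X l)
    (k : Fin (size X l)) : ∃ m : ℤ, v (coweight X l k) = m := by
  induction hv using AddSubgroup.closure_induction with
  | mem x hx =>
    obtain ⟨i, rfl⟩ := hx
    exact ⟨(if i = k then 1 else 0) - if i = k.rev then 1 else 0, by
      rw [diagEntry_coweight]; push_cast; rfl⟩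
  | zero => exact ⟨0, by simp⟩
  | add x y _ _ hx hy =>
    obtain ⟨a, ha⟩ := hx
    obtain ⟨b, hb⟩ := hy
    exact ⟨a + b, by rw [LinearMap.add_apply, ha, hb, Int.cast_add]⟩
  | neg x _ hx =>
    obtain ⟨a, ha⟩ := hx
    exact ⟨-a, by rw [LinearMap.neg_apply, ha, Int.cast_neg]⟩

theorem diagEntry_mem_charLattice (i : Fin (size X l)) : diagEntry X l i ∈ charLattice X l :=
  AddSubgroup.subset_closure ⟨i, rfl⟩

theorem roots_subset_charLattice {α : Module.Dual ℂ (cartan X l)} (hα : α ∈ roots X l) :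
    α ∈ charLattice X l := by
  obtain ⟨-, i, j, -, rfl⟩ := mem_roots.1 hα
  exact sub_mem (diagEntry_mem_charLattice i) (diagEntry_mem_charLattice j)

/-! ### Invariance of the form -/

/-- The linear map `A ↦ ∑ α(A) α`, the sum running over the roots. -/
noncomputable def rootMap (X : Series) (l : ℕ) : cartan X l →ₗ[ℂ] Module.Dual ℂ (cartan X l) :=
  ∑ α ∈ (finite_roots (X := X) (l := l)).toFinset, LinearMap.toSpanSingleton ℂ _ α ∘ₗ α

theorem rootMap_apply (A : cartan X l) :
    rootMap X l A = ∑ α ∈ (finite_roots (X := X) (l := l)).toFinset, α A • α := by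
  simp [rootMap, LinearMap.sum_apply]

/-- The hypothesis says that `B` is the transpose of `f` applied to `A`; the claim then follows by
reindexing the sum along the permutation of the roots by `f`. -/
theorem rootMap_equivariant (f : rootAut X l) {A B : cartan X l}
    (h : ∀ v, (f : Module.Dual ℂ (cartan X l) ≃ₗ[ℂ] Module.Dual ℂ (cartan X l)) v A = v B) :
    f.1 (rootMap X l B) = rootMap X l A := by
  rw [rootMap_apply, rootMap_apply, map_sum]
  refine Finset.sum_bij (fun α _ => f.1 α) (fun α hα => ?_) (fun α _ β _ h => f.1.injective h)
    (fun β hβ => ⟨f.1.symm β, ?_, f.1.apply_symm_apply β⟩) fun α _ => ?_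
  · rw [Set.Finite.mem_toFinset] at *
    exact (f.2 α).2 hα
  · rw [Set.Finite.mem_toFinset] at *
    exact (f.2 _).1 (by rwa [f.1.apply_symm_apply])
  · rw [map_smul, h]

theorem rootMap_coweight_perm {σ : Equiv.Perm (Fin (size X l))}
    (hσ : ∀ i, σ i.rev = (σ i).rev) (i j : Fin (size X l)) :
    rootMap X l (coweight X l (σ i)) (coweight X l (σ j)) =
      rootMap X l (coweight X l i) (coweight X l j) := by
  obtain ⟨w, hw⟩ := exists_weylAction_diagEntry hσ
  have key : ∀ k v, (weylAction X l w : Module.Dual ℂ (cartan X l) ≃ₗ[ℂ]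
      Module.Dual ℂ (cartan X l)) v (coweight X l (σ k)) = v (coweight X l k) := by
    intro k v
    rw [eq_sum_diagEntry v]
    simp only [map_smul, map_sum, hw, LinearMap.smul_apply, LinearMap.sum_apply,
      diagEntry_perm_coweight_perm hσ]
  rw [← rootMap_equivariant _ (key i), key]

theorem rev_swap_apply (i j k : Fin n) :
    (Equiv.swap i j k).rev = Equiv.swap i.rev j.rev k.rev :=
  (Fin.rev_injective.swap_apply i j k).symm

/-- Exchanging `i` and `rev i` negates the coweight of `i` and fixes that of `j`. -/
theorem rootMap_coweight_of_ne {i j : Fin (size X l)} (h1 : j ≠ i) (h2 : j ≠ i.rev) :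
    rootMap X l (coweight X l i) (coweight X l j) = 0 := by
  have hσ : ∀ k, Equiv.swap i i.rev k.rev = (Equiv.swap i i.rev k).rev := by
    intro k
    rw [rev_swap_apply, Fin.rev_rev, Equiv.swap_comm]
  have := rootMap_coweight_perm hσ i j
  rw [Equiv.swap_apply_left, Equiv.swap_apply_of_ne_of_ne h1 h2, coweight_rev, map_neg,
    LinearMap.neg_apply] at this
  exact self_eq_neg.1 this.symm

/-- Exchanging `i` with `j` and simultaneously `rev i` with `rev j` commutes with reversal, because
reversal interchanges the two disjoint transpositions. -/
theorem rootMap_coweight_self_eq {i j : Fin (size X l)} (hi : i.rev ≠ i) (hj : j.rev ≠ j) :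
    rootMap X l (coweight X l i) (coweight X l i) =
      rootMap X l (coweight X l j) (coweight X l j) := by
  by_cases h1 : j = i
  · rw [h1]
  by_cases h2 : j = i.rev
  · rw [h2, coweight_rev]; simp
  have h3 : i ≠ j.rev := fun e => h2 (by rw [e, Fin.rev_rev])
  have hd : (Equiv.swap i j).Disjoint (Equiv.swap i.rev j.rev) := by
    refine Equiv.Perm.disjoint_swap_swap ?_
    simp [Ne.symm h1, Ne.symm hi, h3, h2, Ne.symm hj, Fin.rev_inj]
  have hσ : ∀ k, (Equiv.swap i j * Equiv.swap i.rev j.rev) k.rev =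
      ((Equiv.swap i j * Equiv.swap i.rev j.rev) k).rev := by
    intro k
    rw [Equiv.Perm.mul_apply, Equiv.Perm.mul_apply, rev_swap_apply, rev_swap_apply, Fin.rev_rev,
      Fin.rev_rev]
    exact Equiv.congr_fun hd.commute.eq k.rev
  have := rootMap_coweight_perm hσ i i
  rw [Equiv.Perm.mul_apply, Equiv.swap_apply_of_ne_of_ne hi.symm h3, Equiv.swap_apply_left] at this
  exact this.symm

theorem coweight_eq_zero {i : Fin (size X l)} (hi : i.rev = i) : coweight X l i = 0 := by
  refine cartan_ext fun k => ?_
  have := diagEntry_coweight k i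
  rw [hi, sub_self] at this
  exact this

theorem rootMap_coweight (k i : Fin (size X l)) (hk : k.rev ≠ k) :
    rootMap X l (coweight X l i) =
      rootMap X l (coweight X l k) (coweight X l k) • diagEntry X l i := by
  refine dual_ext fun j => ?_
  rw [LinearMap.smul_apply, diagEntry_coweight, smul_eq_mul]
  by_cases hi : i.rev = i
  · have h0 := coweight_eq_zero hi
    have : (i = j ↔ i = j.rev) := by rw [← Fin.rev_eq_iff, hi]
    simp [h0, this]
  · by_cases h1 : j = i
    · subst h1
      rw [if_pos rfl, if_neg (Ne.symm hi), rootMap_coweight_self_eq hi hk]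
      ring
    · by_cases h2 : j = i.rev
      · subst h2
        rw [if_neg (Ne.symm hi), Fin.rev_rev, if_pos rfl, coweight_rev, map_neg,
          rootMap_coweight_self_eq hi hk]
        ring
      · rw [rootMap_coweight_of_ne h1 h2, if_neg (Ne.symm h1),
          if_neg fun e => h2 (by rw [e, Fin.rev_rev])]
        ring

theorem rootMap_coweight_ne_zero (h : (roots X l).Nonempty) {k : Fin (size X l)} (hk : k.rev ≠ k) :
    rootMap X l (coweight X l k) (coweight X l k) ≠ 0 := by
  obtain ⟨α, hα⟩ := h
  obtain ⟨i, hi⟩ : ∃ i, α (coweight X l i) ≠ 0 := by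
    by_contra! hc
    exact (mem_roots.1 hα).1 (dual_ext hc)
  have hi' : i.rev ≠ i := by
    intro e
    rw [coweight_eq_zero e, map_zero] at hi
    exact hi rfl
  rw [rootMap_coweight_self_eq hk hi', rootMap_apply, LinearMap.sum_apply]
  choose! m hm using fun (β : Module.Dual ℂ (cartan X l)) (hβ : β ∈ roots X l) =>
    exists_int_apply_coweight (roots_subset_charLattice hβ) i
  have : ∑ β ∈ (finite_roots (X := X) (l := l)).toFinset,
      (β (coweight X l i) • β) (coweight X l i) =
      ((∑ β ∈ (finite_roots (X := X) (l := l)).toFinset, m β * m β : ℤ) : ℂ) := by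
    push_cast
    refine Finset.sum_congr rfl fun β hβ => ?_
    rw [LinearMap.smul_apply, smul_eq_mul, hm β ((Set.Finite.mem_toFinset _).1 hβ)]
  -- The scalar is a sum of squares of integers, one of which is nonzero.
  rw [this, Int.cast_ne_zero]
  refine (Finset.sum_pos' (fun β _ => mul_self_nonneg _)
    ⟨α, (Set.Finite.mem_toFinset _).2 hα, mul_self_pos.2 fun h0 => hi ?_⟩).ne'
  rw [hm α hα, h0, Int.cast_zero]

theorem weightForm_map (h : (roots X l).Nonempty) (f : rootAut X l)
    (v w : Module.Dual ℂ (cartan X l)) : weightForm (f.1 v) (f.1 w) = weightForm v w := by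
  by_cases hk : ∃ k : Fin (size X l), k.rev ≠ k
  · obtain ⟨k, hk⟩ := hk
    obtain ⟨c, hc, hco⟩ : ∃ c : ℂ, c ≠ 0 ∧
        ∀ i, rootMap X l (coweight X l i) = c • diagEntry X l i :=
      ⟨_, rootMap_coweight_ne_zero h hk, fun i => rootMap_coweight k i hk⟩
    have hT : ∀ u, rootMap X l (sharp X l u) = c • u := by
      intro u
      rw [eq_sum_diagEntry u]
      simp only [map_smul, map_sum, sharp_diagEntry, hco, Finset.smul_sum,
        smul_smul]
      refine Finset.sum_congr rfl fun i _ => congrArg (· • _) ?_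
      ring
    have hS : ∀ A, sharp X l (rootMap X l A) = c • A := by
      intro A
      rw [eq_sum_coweight A]
      simp only [map_smul, map_sum, hco, sharp_diagEntry, Finset.smul_sum,
        smul_smul]
      refine Finset.sum_congr rfl fun i _ => congrArg (· • _) ?_
      ring
    -- `B` is the transpose of `f` applied to `sharp (f w)`. Equivariance gives `rootMap B = c • w`,
    -- hence `B = sharp w`, which is the invariance.
    obtain ⟨B, hB⟩ : ∃ B : cartan X l, ∀ u, f.1 u (sharp X l (f.1 w)) = u B := by
      refine ⟨(1 / 2 : ℂ) • ∑ k, f.1 (diagEntry X l k) (sharp X l (f.1 w)) • coweight X l k,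
        fun u => ?_⟩
      conv_lhs => rw [eq_sum_diagEntry u]
      simp [mul_comm]
    have h1 := rootMap_equivariant f hB
    rw [hT, ← map_smul, f.1.injective.eq_iff] at h1
    have h2 := congrArg (sharp X l) h1
    rw [hS, map_smul] at h2
    rw [weightForm, hB, weightForm, smul_right_injective _ hc h2]
  -- If every index is fixed by reversal, all `ε_k` vanish and the dual space is zero.
  · push Not at hk
    have : ∀ u : Module.Dual ℂ (cartan X l), u = 0 := fun u => by
      rw [eq_sum_diagEntry u, Finset.sum_eq_zero, smul_zero]
      intro k _
      rw [diagEntry_eq_zero_iff.2 (hk k), smul_zero]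
    rw [this v, this w, map_zero]

/-! ### Automorphisms of the root system permute the weights -/

theorem sub_mem_roots {i j : Fin (size X l)} (hij : i ≠ j) (h : j ≠ i.rev ∨ X = .C) :
    diagEntry X l i - diagEntry X l j ∈ roots X l :=
  mem_roots.2 ⟨sub_ne_zero.2 fun e => hij (diagEntry_injective e), i, j, h, rfl⟩

theorem weightForm_add_right (u v w : Module.Dual ℂ (cartan X l)) :
    weightForm u (v + w) = weightForm u v + weightForm u w := by
  rw [weightForm, map_add, map_add]; rfl

theorem weightForm_eq_sum (v w : Module.Dual ℂ (cartan X l)) :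
    weightForm v w = (1 / 2 : ℂ) * ∑ k, w (coweight X l k) * v (coweight X l k) := by
  change v ((1 / 2 : ℂ) • ∑ k, w (coweight X l k) • coweight X l k) = _
  simp

/-- The coordinates are integers, odd under reversal, and their squares sum to 2 because every pair
is counted twice. So exactly one pair is nonzero, with values `1` and `-1`. -/
theorem exists_eq_diagEntry_of_weightForm_eq_one {v : Module.Dual ℂ (cartan X l)}
    (hv : v ∈ charLattice X l) (h1 : weightForm v v = 1) : ∃ j, v = diagEntry X l j := by
  choose m hm using exists_int_apply_coweight hv
  have hrev : ∀ k, m k.rev = -m k := fun k => by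
    have h : ((m k.rev : ℤ) : ℂ) = ((-m k : ℤ) : ℂ) := by
      rw [← hm, coweight_rev, map_neg, hm, Int.cast_neg]
    exact_mod_cast h
  have hsum : ∑ k, m k * m k = 2 := by
    rw [weightForm_eq_sum] at h1
    simp only [hm] at h1
    have h2 : ((∑ k, m k * m k : ℤ) : ℂ) = ((2 : ℤ) : ℂ) := by
      push_cast
      linear_combination 2 * h1
    exact_mod_cast h2
  obtain ⟨k, hk⟩ : ∃ k, 0 < m k := by
    by_contra! hc
    have h0 : ∀ k, m k = 0 := fun k => le_antisymm (hc k) (by have := hc k.rev; rw [hrev] at this; omega)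
    simp [h0] at hsum
  have hkr : k.rev ≠ k := fun e => by
    have := hrev k
    rw [e] at this
    omega
  have hle : ∀ s : Finset (Fin (size X l)), ∑ i ∈ s, m i * m i ≤ 2 := fun s =>
    (Finset.sum_le_univ_sum_of_nonneg fun i => mul_self_nonneg _).trans hsum.le
  have hk1 : m k = 1 := by
    have := hle {k, k.rev}
    rw [Finset.sum_pair hkr.symm, hrev] at this
    nlinarith
  have h0 : ∀ j, j ≠ k → j ≠ k.rev → m j = 0 := by
    intro j h2 h3
    have := hle {j, k, k.rev}
    rw [Finset.sum_insert (by simp [h2, h3]), Finset.sum_pair hkr.symm, hrev, hk1] at this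
    exact mul_self_eq_zero.1 (le_antisymm (by linarith) (mul_self_nonneg _))
  refine ⟨k, dual_ext fun j => ?_⟩
  rw [hm, diagEntry_coweight]
  by_cases h2 : j = k
  · subst h2
    rw [hk1, if_pos rfl, if_neg hkr.symm]
    simp
  · by_cases h3 : j = k.rev
    · subst h3
      rw [hrev, hk1, if_neg hkr.symm, Fin.rev_rev, if_pos rfl]
      simp
    · rw [h0 j h2 h3, if_neg (Ne.symm h2), if_neg fun e => h3 (by rw [e, Fin.rev_rev])]
      simp

theorem weightForm_diagEntry_self {i : Fin (size X l)} (hi : i.rev ≠ i) :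
    weightForm (diagEntry X l i) (diagEntry X l i) = 1 := by
  rw [weightForm_diagEntry, if_pos rfl, if_neg hi.symm, sub_zero]

theorem exists_map_diagEntry_of_mem_charLattice (h : (roots X l).Nonempty) (f : rootAut X l)
    {i : Fin (size X l)} (hf : f.1 (diagEntry X l i) ∈ charLattice X l) :
    ∃ j, f.1 (diagEntry X l i) = diagEntry X l j := by
  by_cases hi : i.rev = i
  · exact ⟨i, by rw [diagEntry_eq_zero_iff.2 hi, map_zero]⟩
  · exact exists_eq_diagEntry_of_weightForm_eq_one hf
      (by rw [weightForm_map h, weightForm_diagEntry_self hi])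

theorem roots_nonempty (hl : 1 ≤ l) (hD : ¬(X = .D ∧ l = 1)) : (roots X l).Nonempty := by
  have h0 : 0 < size X l := by cases X <;> simp only [size] <;> omega
  by_cases hX : X = .C
  · refine ⟨_, sub_mem_roots (i := ⟨0, h0⟩) (j := Fin.rev ⟨0, h0⟩) ?_ (.inr hX)⟩
    exact (rev_ne_self (by rw [hX]; simp) _).symm
  · have h2 : 2 < size X l := by
      cases X with
      | C => exact absurd rfl hX
      | B => simp only [size]; omega
      | D => simp only [true_and] at hD; simp only [size]; omega
    refine ⟨_, sub_mem_roots (i := ⟨0, h0⟩) (j := ⟨1, by omega⟩) (by simp) (.inl fun e => ?_)⟩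
    have := congrArg Fin.val e
    rw [Fin.val_rev] at this
    simp only at this
    omega

/-- There are no roots here, so invariance of the form is unavailable. The dual is a line, and `f`
and its inverse act on `ε_i` by integers with product 1. -/
theorem exists_map_diagEntry_D_one (f : rootAut .D 1)
    (hf : ∀ v, f.1 v ∈ charLattice .D 1 ↔ v ∈ charLattice .D 1) (i : Fin (size .D 1)) :
    ∃ j, f.1 (diagEntry .D 1 i) = diagEntry .D 1 j := by
  have key : ∀ v : Module.Dual ℂ (cartan .D 1),
      v = v (coweight .D 1 i) • diagEntry .D 1 i := by
    intro v
    refine dual_ext fun k => ?_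
    have hi : (i : ℕ) < 2 := i.2
    have hk : (k : ℕ) < 2 := k.2
    have hr : (i.rev : ℕ) = 2 - (i + 1) := Fin.val_rev i
    have hir : i ≠ i.rev := fun e => by
      have := congrArg Fin.val e
      omega
    rw [LinearMap.smul_apply, smul_eq_mul, diagEntry_coweight]
    rcases eq_or_ne k i with rfl | hne
    · rw [if_pos rfl, if_neg hir]; ring
    · have : k = i.rev := Fin.ext (by
        have : (k : ℕ) ≠ i := fun e => hne (Fin.ext e)
        omega)
      subst this
      rw [if_neg hir, Fin.rev_rev, if_pos rfl, coweight_rev, map_neg]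
      ring
  have hi := diagEntry_mem_charLattice i
  obtain ⟨a, ha⟩ := exists_int_apply_coweight ((hf _).2 hi) i
  obtain ⟨b, hb⟩ := exists_int_apply_coweight
    ((hf (f.1.symm (diagEntry .D 1 i))).1 (by rwa [f.1.apply_symm_apply])) i
  have h1 := key (f.1 (diagEntry .D 1 i))
  have h2 := key (f.1.symm (diagEntry .D 1 i))
  rw [ha] at h1
  rw [hb] at h2
  have h3 : diagEntry .D 1 i = ((a * b : ℤ) : ℂ) • diagEntry .D 1 i := by
    have := congrArg f.1 h2
    rw [f.1.apply_symm_apply, map_smul, h1, smul_smul] at this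
    rw [mul_comm]
    exact_mod_cast this
  have h4 : diagEntry .D 1 i ≠ 0 := fun e =>
    rev_ne_self (by simp) i (diagEntry_eq_zero_iff.1 e)
  have h5 : a * b = 1 := by
    have h6 : (((a * b : ℤ) : ℂ) - 1) • diagEntry .D 1 i = 0 := by
      rw [sub_smul, one_smul, ← h3, sub_self]
    have h7 := sub_eq_zero.1 ((smul_eq_zero.1 h6).resolve_right h4)
    exact_mod_cast h7
  rcases Int.eq_one_or_neg_one_of_mul_eq_one h5 with rfl | rfl
  · exact ⟨i, by rw [h1]; simp⟩
  · exact ⟨i.rev, by rw [h1, diagEntry_rev]; simp⟩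

theorem mem_range_weylAction_iff (hl : 1 ≤ l) (f : rootAut X l) :
    f ∈ (weylAction X l).range ↔ ∀ v, f.1 v ∈ charLattice X l ↔ v ∈ charLattice X l := by
  constructor
  · rintro ⟨w, rfl⟩ v
    exact weylAction_mem_charLattice_iff w v
  · intro h
    refine mem_range_weylAction fun i => ?_
    by_cases hD : X = .D ∧ l = 1
    · obtain ⟨rfl, rfl⟩ := hD
      exact exists_map_diagEntry_D_one f h i
    · exact exists_map_diagEntry_of_mem_charLattice (roots_nonempty hl hD) f
        ((h _).2 (diagEntry_mem_charLattice i))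

theorem exists_map_diagEntry_B (hl : 1 ≤ l) (f : rootAut .B l) (i : Fin (size .B l)) :
    ∃ j, f.1 (diagEntry .B l i) = diagEntry .B l j := by
  have hm : (middle l).rev = middle l := rev_eq_self_iff.2 rfl
  by_cases hi : i = middle l
  · exact ⟨i, by rw [diagEntry_eq_zero_iff.2 (rev_eq_self_iff.2 hi), map_zero]⟩
  · refine exists_map_diagEntry_of_mem_charLattice (roots_nonempty hl (by simp)) f
      (roots_subset_charLattice ((f.2 _).2 ?_))
    -- The weight at the middle index is zero, so `ε_i` is itself a root.
    rw [← sub_zero (diagEntry _ _ i), ← diagEntry_eq_zero_iff.2 hm]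
    refine sub_mem_roots hi (.inl fun e => hi ?_)
    rw [← Fin.rev_rev i, ← e, hm]

theorem exists_map_diagEntry_of_add {f : rootAut X l} {i j : Fin (size X l)}
    (h : f.1 (diagEntry X l i + diagEntry X l i) = diagEntry X l j + diagEntry X l j) :
    ∃ j, f.1 (diagEntry X l i) = diagEntry X l j := by
  refine ⟨j, ?_⟩
  rw [map_add, ← two_smul ℂ, ← two_smul ℂ] at h
  exact smul_right_injective _ (two_ne_zero' ℂ) h

/-- The root `2ε_i` has norm 4, whereas `ε_a - ε_b` with `a ≠ b` and `a ≠ rev b` has norm 2; so the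
image is again of the form `2ε_a`. -/
theorem exists_map_diagEntry_C (hl : 1 ≤ l) (f : rootAut .C l) (i : Fin (size .C l)) :
    ∃ j, f.1 (diagEntry .C l i) = diagEntry .C l j := by
  have hfix : ∀ i : Fin (size .C l), i.rev ≠ i := rev_ne_self (by simp)
  have hr : diagEntry .C l i + diagEntry .C l i ∈ roots .C l := by
    have := sub_mem_roots (hfix i).symm (.inr rfl)
    rwa [diagEntry_rev, sub_neg_eq_add] at this
  obtain ⟨h0, a, b, -, hab⟩ := mem_roots.1 ((f.2 _).2 hr)
  have hne : a ≠ b := by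
    rintro rfl
    rw [hab, sub_self] at h0
    exact h0 rfl
  have hQ := weightForm_map (roots_nonempty hl (by simp)) f (diagEntry .C l i + diagEntry .C l i)
    (diagEntry .C l i + diagEntry .C l i)
  rw [hab] at hQ
  simp only [weightForm_sub_left, weightForm_sub_right, weightForm_add_left, weightForm_add_right,
    weightForm_diagEntry_self (hfix _)] at hQ
  rw [weightForm_diagEntry, weightForm_diagEntry, if_neg hne, if_neg hne.symm] at hQ
  have hrev : a = b.rev := by
    by_contra hc
    rw [if_neg hc] at hQ
    split_ifs at hQ <;> norm_num at hQ
  refine exists_map_diagEntry_of_add (j := a) ?_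
  rw [hab, sub_eq_add_neg, ← diagEntry_rev, ← hrev]

theorem exists_notMem_of_length_lt (s : List (Fin n)) (h : s.length < n) : ∃ i, i ∉ s := by
  by_contra! hc
  have h1 : (Finset.univ : Finset (Fin n)) ⊆ s.toFinset := fun i _ => List.mem_toFinset.2 (hc i)
  have h2 := (Finset.card_le_card h1).trans (List.toFinset_card_le s)
  rw [Finset.card_univ, Fintype.card_fin] at h2
  omega

/-- Two orthogonal roots `ε_a - ε_b`, `ε_c - ε_d` of type `D` have the same or disjoint supports. -/
theorem orthogonal_roots_cases {a b c d : Fin n} (hfix : ∀ i : Fin n, i.rev ≠ i)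
    (h1 : a ≠ b) (h2 : b ≠ a.rev) (h3 : c ≠ d) (h4 : d ≠ c.rev)
    (hQ : ((if a = c then 1 else 0) - (if a = c.rev then 1 else 0) : ℤ) -
      ((if a = d then 1 else 0) - (if a = d.rev then 1 else 0)) -
      (((if b = c then 1 else 0) - (if b = c.rev then 1 else 0)) -
      ((if b = d then 1 else 0) - (if b = d.rev then 1 else 0))) = 0) :
    (a = c ∧ b = d.rev) ∨ (a = c.rev ∧ b = d) ∨ (b = c ∧ a = d.rev) ∨ (b = c.rev ∧ a = d) ∨
      (a ≠ c ∧ a ≠ c.rev ∧ a ≠ d ∧ a ≠ d.rev ∧ b ≠ c ∧ b ≠ c.rev ∧ b ≠ d ∧ b ≠ d.rev) := by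
  have hc := hfix c
  have hd := hfix d
  have hr := Fin.rev_rev c
  have hr' := Fin.rev_rev d
  have hi : d.rev ≠ c.rev := fun e => h3 (Fin.rev_injective e).symm
  grind (splits := 30)

/-- The eight listed indices are distinct, so `n ≥ 8`, and `n ≠ 8` leaves room for a ninth. -/
theorem exists_notMem_of_disjoint_pairs {a b c d : Fin n} (hn : n ≠ 8)
    (hfix : ∀ i : Fin n, i.rev ≠ i) (hab0 : a ≠ b) (hab : a ≠ b.rev) (hcd0 : c ≠ d)
    (hcd : c ≠ d.rev) (h : a ≠ c ∧ a ≠ c.rev ∧ a ≠ d ∧ a ≠ d.rev ∧ b ≠ c ∧ b ≠ c.rev ∧ b ≠ d ∧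
      b ≠ d.rev) : ∃ e, e ∉ [a, a.rev, b, b.rev, c, c.rev, d, d.rev] := by
  obtain ⟨n1, n2, n3, n4, n5, n6, n7, n8⟩ := h
  have hrevne : ∀ {x y : Fin n}, x ≠ y.rev → x.rev ≠ y := fun h e => h (by rw [← e, Fin.rev_rev])
  have hnodup : [a, a.rev, b, b.rev, c, c.rev, d, d.rev].Nodup := by
    simp [Fin.rev_inj, (hfix _).symm, hab0, hcd0, n1, n2, n3, n4, n5, n6, n7, n8, hrevne n2,
      hrevne n4, hrevne n6, hrevne n8, hrevne hab, hrevne hcd, hab, hcd]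
  have h8 : 8 ≤ n := by simpa using hnodup.length_le_card
  exact exists_notMem_of_length_lt _ (lt_of_le_of_ne h8 hn.symm)

/-- Parity obstruction: with `e` outside the supports, the root `ε_a - ε_e` pairs to 1 with the
image of `2ε_i`, while its preimage, also a root, pairs to an even integer with `2ε_i`. In rank 4
four disjoint pairs exhaust the indices, leaving room for triality. -/
theorem not_disjoint_pairs_of_map_eq (f : rootAut .D l) (h4 : l ≠ 4) (hne : (roots .D l).Nonempty)
    {i a b c d : Fin (size .D l)}
    (hf : f.1 (diagEntry .D l i + diagEntry .D l i) =
      (diagEntry .D l a - diagEntry .D l b) + (diagEntry .D l c - diagEntry .D l d))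
    (hab0 : a ≠ b) (hab : a ≠ b.rev) (hcd0 : c ≠ d) (hcd : c ≠ d.rev) :
    ¬(a ≠ c ∧ a ≠ c.rev ∧ a ≠ d ∧ a ≠ d.rev ∧ b ≠ c ∧ b ≠ c.rev ∧ b ≠ d ∧ b ≠ d.rev) := by
  intro h
  have hfix : ∀ i : Fin (size .D l), i.rev ≠ i := rev_ne_self (by simp)
  have h8 : size .D l ≠ 8 := by
    change 2 * l ≠ 8
    omega
  obtain ⟨e, he⟩ := exists_notMem_of_disjoint_pairs h8 hfix hab0 hab hcd0 hcd h
  obtain ⟨n1, n2, n3, n4, -⟩ := h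
  simp only [List.mem_cons, List.not_mem_nil, or_false, not_or] at he
  obtain ⟨e1, e2, e3, e4, e5, e6, e7, e8⟩ := he
  obtain ⟨γ, hγ⟩ := f.1.surjective (diagEntry .D l a - diagEntry .D l e)
  have hγr : γ ∈ roots .D l := (f.2 γ).1 (hγ ▸ sub_mem_roots (Ne.symm e1) (.inl e2))
  obtain ⟨m, hm⟩ := exists_int_apply_coweight (roots_subset_charLattice hγr) i
  have hE := weightForm_map hne f γ (diagEntry .D l i + diagEntry .D l i)
  rw [hγ, hf, weightForm_add_right γ, weightForm_diagEntry_right, hm] at hE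
  simp only [weightForm_sub_left, weightForm_sub_right, weightForm_add_right,
    weightForm_diagEntry_self (hfix _)] at hE
  simp only [weightForm_diagEntry, if_neg hab0, if_neg n1, if_neg n2,
    if_neg n3, if_neg n4, if_neg e1, if_neg e2, if_neg e3, if_neg e4, if_neg e5, if_neg e6,
    if_neg e7, if_neg e8, if_neg hab] at hE
  have : (1 : ℤ) = m + m := by
    have h : ((1 : ℤ) : ℂ) = ((m + m : ℤ) : ℂ) := by
      push_cast
      linear_combination hE
    exact_mod_cast h
  omega

/-- Write `2ε_i = (ε_i - ε_j) + (ε_i + ε_j)`, a sum of orthogonal roots. The images are orthogonal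
roots; if their supports agree they sum to some `2ε_k`, and disjoint supports are excluded by
`not_disjoint_pairs_of_map_eq`. -/
theorem exists_map_diagEntry_D (hl : 2 ≤ l) (h4 : l ≠ 4) (f : rootAut .D l)
    (i : Fin (size .D l)) : ∃ j, f.1 (diagEntry .D l i) = diagEntry .D l j := by
  have hfix : ∀ i : Fin (size .D l), i.rev ≠ i := rev_ne_self (by simp)
  have hne := roots_nonempty (X := .D) (l := l) (by omega) (by omega)
  obtain ⟨j, hj⟩ := exists_notMem_of_length_lt [i, i.rev] (show 2 < 2 * l by omega)
  simp only [List.mem_cons, List.not_mem_nil, or_false, not_or] at hj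
  obtain ⟨hji, hjr⟩ := hj
  have hjr' : i ≠ j.rev := fun e => hjr (by rw [e, Fin.rev_rev])
  have hα := sub_mem_roots (X := .D) (Ne.symm hji) (.inl hjr)
  have hβ := sub_mem_roots (X := .D) hjr' (.inl fun e => hji (Fin.rev_injective e))
  have hsum : diagEntry .D l i + diagEntry .D l i =
      (diagEntry .D l i - diagEntry .D l j) + (diagEntry .D l i - diagEntry .D l j.rev) := by
    rw [diagEntry_rev]; abel
  have hQ := weightForm_map hne f (diagEntry .D l i - diagEntry .D l j)
    (diagEntry .D l i - diagEntry .D l j.rev)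
  obtain ⟨hα0, a, b, hab', hab⟩ := mem_roots.1 ((f.2 _).2 hα)
  obtain ⟨hβ0, c, d, hcd', hcd⟩ := mem_roots.1 ((f.2 _).2 hβ)
  have hf : f.1 (diagEntry .D l i + diagEntry .D l i) =
      (diagEntry .D l a - diagEntry .D l b) + (diagEntry .D l c - diagEntry .D l d) := by
    rw [hsum, map_add, hab, hcd]
  replace hab' := hab'.resolve_right (by simp)
  replace hcd' := hcd'.resolve_right (by simp)
  have hab0 : a ≠ b := by rintro rfl; rw [hab, sub_self] at hα0; exact hα0 rfl
  have hcd0 : c ≠ d := by rintro rfl; rw [hcd, sub_self] at hβ0; exact hβ0 rfl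
  rw [hab, hcd] at hQ
  simp only [weightForm_sub_left, weightForm_sub_right, weightForm_diagEntry, Fin.rev_rev,
    if_neg hjr', if_neg (hfix _).symm, if_pos, if_neg hji,
    if_neg (Ne.symm hji), if_neg hjr] at hQ
  have hQ' := orthogonal_roots_cases hfix hab0 hab' hcd0 hcd' (by
    have : ((((if a = c then 1 else 0) - (if a = c.rev then 1 else 0) : ℤ) -
      ((if a = d then 1 else 0) - (if a = d.rev then 1 else 0)) -
      (((if b = c then 1 else 0) - (if b = c.rev then 1 else 0)) -
      ((if b = d then 1 else 0) - (if b = d.rev then 1 else 0))) : ℤ) : ℂ) = 0 := by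
      push_cast
      linear_combination hQ
    exact_mod_cast this)
  rcases hQ' with ⟨rfl, rfl⟩ | ⟨rfl, rfl⟩ | ⟨rfl, rfl⟩ | ⟨rfl, rfl⟩ | hQ'
  · refine exists_map_diagEntry_of_add (j := a) (hf.trans ?_)
    rw [diagEntry_rev]; abel
  · refine exists_map_diagEntry_of_add (j := b.rev) (hf.trans ?_)
    rw [diagEntry_rev, diagEntry_rev]; abel
  · refine exists_map_diagEntry_of_add (j := d.rev) (hf.trans ?_)
    rw [diagEntry_rev]; abel
  · refine exists_map_diagEntry_of_add (j := c) (hf.trans ?_)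
    rw [diagEntry_rev]; abel
  · exact (not_disjoint_pairs_of_map_eq f h4 hne hf hab0
      (fun h => hab' (by rw [h, Fin.rev_rev])) hcd0 (fun h => hcd' (by rw [h, Fin.rev_rev])) hQ').elim

theorem weylAction_bijective (hl : 1 ≤ l) (h : ¬(X = .D ∧ (l = 1 ∨ l = 4))) :
    Function.Bijective (weylAction X l) := by
  refine ⟨weylAction_injective, fun f => mem_range_weylAction fun i => ?_⟩
  cases X with
  | B => exact exists_map_diagEntry_B hl f i
  | C => exact exists_map_diagEntry_C hl f i
  | D =>
    simp only [true_and] at h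
    exact exists_map_diagEntry_D (by omega) (by omega) f i

end ClassicalTorus

theorem mainTheorem2 (X : Series) (l : ℕ) (hl : 1 ≤ l) :
    -- the diagonal torus contains a maximal torus of `G`
    (∃ T : Subgroup (GL (Fin (size X l)) ℂ),
      IsMaximalTorus (classicalGroup X l) T ∧
        T ≤ diagTorus (size X l)) ∧
    -- for every such maximal torus `T`, with `H_G := C_G(T)`:
    ∀ T H_G : Subgroup (GL (Fin (size X l)) ℂ),
      IsMaximalTorus (classicalGroup X l) T →
      T ≤ diagTorus (size X l) →
      H_G = relCentralizer (classicalGroup X l) T →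
      -- `H_G` is a maximal commutative subgroup; it is `T` in types `C` and `D`, and it is
      -- `T × {±1}` in type `B`
      Maximal (fun A : Subgroup (GL (Fin (size X l)) ℂ) =>
        A ≤ classicalGroup X l ∧ IsMulCommutative A) H_G ∧
      (X ≠ Series.B → H_G = T) ∧
      (X = Series.B →
        H_G = T ⊔ Subgroup.zpowers (-1) ∧ Disjoint T (Subgroup.zpowers (-1))) ∧
      -- the fixed part of the diagonal torus
      fixedPart X l (diagTorus (size X l)) = H_G ∧
      -- the fixed part of the normalizer
      fixedPart X l (diagNormalizer (size X l)) =
        relNormalizer (classicalGroup X l) H_G ∧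
      -- the fixed part of the Weyl group is `N_G(H_G) / H_G`
      (∃ Ψ : (relNormalizer (classicalGroup X l) H_G ⧸
            H_G.subgroupOf
              (relNormalizer (classicalGroup X l) H_G)) ≃*
          fixedWeyl X l,
        ∀ g : relNormalizer (classicalGroup X l) H_G,
          ∃ hg : (g : GL (Fin (size X l)) ℂ) ∈
              diagNormalizer (size X l),
            (Ψ (QuotientGroup.mk g) : WeylGL (size X l)) =
              QuotientGroup.mk ⟨g, hg⟩) ∧
      -- the fixed part of the Weyl group is `Aut(Φ_G)`, through its conjugation action on the
      -- Cartan subalgebra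
      ∃ φ : fixedWeyl X l →* rootAut X l,
        (∀ (g : diagNormalizer (size X l))
            (hg : (QuotientGroup.mk g : WeylGL (size X l)) ∈
              fixedWeyl X l)
            (A : cartan X l),
          ∃ hA : ((g : GL (Fin (size X l)) ℂ) :
                Matrix (Fin (size X l)) (Fin (size X l)) ℂ) * A *
              ((g : GL (Fin (size X l)) ℂ)⁻¹ :
                GL (Fin (size X l)) ℂ) ∈ cartan X l,
            ∀ v : Module.Dual ℂ (cartan X l),
              (φ ⟨QuotientGroup.mk g, hg⟩ : Module.Dual ℂ (cartan X l) ≃ₗ[ℂ]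
                Module.Dual ℂ (cartan X l)) v ⟨_, hA⟩ = v A) ∧
        Function.Injective φ ∧
        (∀ f : rootAut X l, f ∈ φ.range ↔
          ∀ v, (f : Module.Dual ℂ (cartan X l) ≃ₗ[ℂ]
            Module.Dual ℂ (cartan X l)) v ∈ charLattice X l ↔
              v ∈ charLattice X l) ∧
        (¬(X = Series.D ∧ (l = 1 ∨ l = 4)) → Function.Bijective φ) := by
  refine ⟨⟨splitTorus _, isMaximalTorus_splitTorus, splitTorus_le_diagTorus⟩, ?_⟩
  rintro T H_G hT hD rfl
  obtain rfl := hT.eq_splitTorus hD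
  rw [relCentralizer_splitTorus]
  refine ⟨maximal_commutative_fixedPart, fixedPart_diagTorus_of_ne, ?_, rfl,
    fixedPart_diagNormalizer, ⟨quotientEquivFixedWeyl X l, fun g => ?_⟩, weylAction X l,
    weylAction_apply, weylAction_injective, mem_range_weylAction_iff hl, weylAction_bijective hl⟩
  · rintro rfl
    exact ⟨fixedPart_diagTorus_B, disjoint_splitTorus_zpowers⟩
  · exact ⟨relNormalizer_le_diagNormalizer g.2, by rw [quotientEquivFixedWeyl_mk, coe_toFixedWeyl]⟩
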